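/- Let $d \ge 1$, let $\mathbb{B}^d$ be the open unit ball of $\mathbb{C}^d$ with boundary the unit sphere $\partial\mathbb{B}^d$, and let $\sigma$ be the normalised rotation-invariant Lebesgue measure on $\partial\mathbb{B}^d$. Order the multi-indices $\mathbb{N}_0^d$ by the short lexicographical order $\preceq$ (first by length $|\alpha| = \alpha_1 + \dots + \alpha_d$, then lexicographically with $e_1 \prec \dots \prec e_d$). A probability measure $\mu$ on $\partial\mathbb{B}^d$ is called non-trivial if for every $\alpha \in \mathbb{N}_0^d$ the matrix $\big[\int_{\partial\mathbb{B}^d} \zeta^{\alpha'} \overline{\zeta}^{\beta'} \, d\mu(\zeta)\big]_{0 \preceq \alpha', \beta' \preceq \alpha}$ is invertible. For such $\mu$ let $(\varphi_\alpha)_{\alpha \in \mathbb{N}_0^d}$ be the orthonormal polynomials obtained by applying the Gram--Schmidt process, with respect to $\langle p, q\rangle_\mu = \int p\,\overline{q}\, d\mu$, to the monomials $z^\alpha$ in the order $\preceq$, and let $$\lambda_n^{(d)}(z; d\mu) = \Big(\sum_{0 \preceq \alpha \preceq (0, \dots, 0, n)} |\varphi_\alpha(z)|^2\Big)^{-1},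 \qquad \lambda_\infty^{(d)}(z; d\mu) = \lim_{n \to \infty} \lambda_n^{(d)}(z; d\mu)$$ be the Christoffel approximates and the Christoffel function of $\mu$. Let $\mu$ be a non-trivial probability measure on $\partial\mathbb{B}^d$ with Lebesgue decomposition $d\mu = w\, d\sigma + d\mu_{\mathrm{s}}$, where $0 \le w \in L^1(\sigma)$ and $\mu_{\mathrm{s}}$ is singular with respect to $\sigma$, and suppose that $\mu_{\mathrm{s}}$ is discrete, i.e. a countable (possibly empty) sum of point masses. Suppose that there exists a bounded holomorphic function $f \in H^\infty(\mathbb{B}^d)$ such that $f(0) = 1$ and $$\int_{\partial\mathbb{B}^d} |f(\zeta)|^2 w(\zeta) \, d\sigma(\zeta) \le \exp\left(\int_{\partial\mathbb{B}^d} \log w(\zeta) \, d\sigma(\zeta)\right),$$ where, for $\sigma$-almost every $\zeta \in \partial\mathbb{B}^d$, $f(\zeta)$ denotes the K-limit of $f$ at $\zeta$ (the common limit of $f(z)$ as $z \to \zeta$ within each of the Korányi regions $\{z \in \mathbb{B}^d : |1 - \langle z, \zeta\rangle| < \tfrac{a}{2}(1 - |z|^2)\}$, $a > 1$), and where $\int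 \log w\, d\sigma \in [-\infty, \infty)$, with $\log 0 = -\infty$ and $\exp(-\infty) = 0$. Then the limit defining $\lambda_\infty^{(d)}(0; d\mu)$ exists and $$\lambda_\infty^{(d)}(0; d\mu) = \exp\left(\int_{\partial\mathbb{B}^d} \log w(\zeta) \, d\sigma(\zeta)\right).$$ -/

import Mathlib

open MeasureTheory Filter Topology
open scoped ENNReal

namespace SzegoBall

/-! ### Multi-indices with the short lexicographical order -/

/-- Multi-indices `α ∈ ℕ₀ᵈ`, as a structure so that they do not carry the componentwise order. -/
@[ext]
structure MultiIndex (d : ℕ) where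
  /-- The entries `α₁, …, α_d`. -/
  entry : Fin d → ℕ

namespace MultiIndex

variable {d : ℕ}

/-- The length `|α| = α₁ + ⋯ + α_d`. -/
def length (α : MultiIndex d) : ℕ := ∑ i, α.entry i

/-- The sorting key of the shortlex order: first the length, then lexicographically with
`e₁ ≺ e₂ ≺ ⋯ ≺ e_d`, whence the order dual in the second component; see `lt_iff`. -/
def key (α : MultiIndex d) : ℕ ×ₗ (Lex (Fin d → ℕ))ᵒᵈ :=
  toLex (α.length, OrderDual.toDual (toLex α.entry))

theorem key_injective : Function.Injective (key : MultiIndex d → _) := 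
  fun α β h => by
    have h2 : (ofLex (key α)).2 = (ofLex (key β)).2 := by rw [h]
    exact MultiIndex.ext h2

/-- The short lexicographical order. -/
noncomputable instance : LinearOrder (MultiIndex d) := LinearOrder.lift' key key_injective

/-- `α ≺ β` iff `|α| < |β|`, or `|α| = |β|` and, at the first place where they differ, `α` has
the larger entry: `(0,0), (1,0), (0,1), (2,0), (1,1), (0,2), …`. -/
theorem lt_iff {α β : MultiIndex d} :
    α < β ↔ α.length < β.length ∨
      (α.length = β.length ∧ ∃ i, (∀ j < i, α.entry j = β.entry j) ∧ β.entry i < α.entry i) := by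
  have h : α < β ↔ key α < key β := Iff.rfl
  have h2 : toLex β.entry < toLex α.entry ↔
      ∃ i, (∀ j < i, β.entry j = α.entry j) ∧ β.entry i < α.entry i := Iff.rfl
  rw [h, Prod.Lex.lt_iff]
  refine or_congr Iff.rfl (and_congr Iff.rfl (h2.trans ?_))
  simp only [eq_comm]

theorem length_le_of_le {α β : MultiIndex d} (h : α ≤ β) : α.length ≤ β.length := by
  rcases h.lt_or_eq with h | rfl
  · rcases lt_iff.1 h with h | h
    · exact h.le
    · exact h.1.le
  · exact le_rfl

/-- Each multi-index has only finitely many predecessors. -/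
noncomputable instance : LocallyFiniteOrderBot (MultiIndex d) :=
  LocallyFiniteOrderBot.ofIic (MultiIndex d)
    (fun α => ((Fintype.piFinset fun _ : Fin d => Finset.range (α.length + 1)).map
      ⟨MultiIndex.mk, fun _ _ h => congrArg entry h⟩).filter (· ≤ α))
    (by
      intro α β
      simp only [Finset.mem_filter, and_iff_right_iff_imp]
      intro h
      refine Finset.mem_map.2 ⟨β.entry, Fintype.mem_piFinset.2 fun i =>
        Finset.mem_range.2 (Nat.lt_succ_of_le ?_), rfl⟩
      exact (Finset.single_le_sum (f := β.entry) (fun _ _ => Nat.zero_le _)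
        (Finset.mem_univ i)).trans (length_le_of_le h))

instance : WellFoundedLT (MultiIndex d) :=
  StrictMono.wellFoundedLT (f := fun α : MultiIndex d => (Finset.Iio α).card) fun α _ h =>
    Finset.card_lt_card (Finset.ssubset_iff_subset_ne.2 ⟨fun _ hγ =>
      Finset.mem_Iio.2 ((Finset.mem_Iio.1 hγ).trans h), fun he =>
      lt_irrefl α (Finset.mem_Iio.1 (he ▸ Finset.mem_Iio.2 h))⟩)

/-- `α(n) = (0, …, 0, n)`, the last multi-index of length `n`. -/
def last (n : ℕ) : MultiIndex d := ⟨fun i => if (i : ℕ) + 1 = d then n else 0⟩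

end MultiIndex

/-! ### Measures on the unit sphere of `ℂᵈ` -/

/-- The unit sphere `∂𝔹ᵈ` of `ℂᵈ`. -/
abbrev Sphere (d : ℕ) : Type := Metric.sphere (0 : EuclideanSpace ℂ (Fin d)) 1

/-- The normalised rotation-invariant Lebesgue measure `σ` on `∂𝔹ᵈ`. -/
noncomputable def sigma (d : ℕ) : Measure (Sphere d) :=
  ((volume : Measure (EuclideanSpace ℂ (Fin d))).toSphere Set.univ)⁻¹ •
    (volume : Measure (EuclideanSpace ℂ (Fin d))).toSphere

/-- A discrete measure: one that is carried by a countable set, i.e. a countable (possibly empty)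
sum of point masses. -/
def IsDiscrete {X : Type*} [MeasurableSpace X] (ν : Measure X) : Prop :=
  ∃ S : Set X, S.Countable ∧ ν Sᶜ = 0

variable {d : ℕ}

/-- The monomial `z^α`. -/
noncomputable def mono (α : MultiIndex d) : MvPolynomial (Fin d) ℂ :=
  ∏ i, MvPolynomial.X i ^ α.entry i

/-- The value of a polynomial at a point of `ℂᵈ`. -/
noncomputable def polyEval (p : MvPolynomial (Fin d) ℂ) (z : EuclideanSpace ℂ (Fin d)) : ℂ :=
  MvPolynomial.eval (fun i => z i) p

/-- The pre-inner product `⟨p, q⟩_μ = ∫ p(ζ) conj(q(ζ)) dμ(ζ)` of polynomials. -/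
noncomputable def polyInner (μ : Measure (Sphere d)) (p q : MvPolynomial (Fin d) ℂ) : ℂ :=
  ∫ ζ : Sphere d, polyEval p ζ * (starRingEnd ℂ) (polyEval q ζ) ∂μ

/-- The moment kernel `K(α, β) = ∫ ζ^α conj(ζ)^β dμ(ζ)`. -/
noncomputable def momentKernel (μ : Measure (Sphere d)) (α β : MultiIndex d) : ℂ :=
  polyInner μ (mono α) (mono β)

/-- `μ` is non-trivial if every moment matrix `[K(α', β')]_{0 ≼ α', β' ≼ α}` is invertible. -/
def IsNontrivial (μ : Measure (Sphere d)) : Prop :=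
  ∀ α : MultiIndex d,
    IsUnit (Matrix.of fun β γ : Finset.Iic α => momentKernel μ (β : MultiIndex d) γ)

/-! ### Orthogonal polynomials and the Christoffel function -/

/-- The monic orthogonal polynomials `Φ_α`: Gram–Schmidt without normalisation, applied to the
monomials in shortlex order. -/
noncomputable def monicOP (μ : Measure (Sphere d)) (α : MultiIndex d) :
    MvPolynomial (Fin d) ℂ :=
  mono α - ∑ β : Finset.Iio α,
    (polyInner μ (mono α) (monicOP μ β) / polyInner μ (monicOP μ β) (monicOP μ β)) •
      monicOP μ β
termination_by (wellFounded_lt : WellFounded ((· < ·) : MultiIndex d → MultiIndex d → Prop)).wrap α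
decreasing_by all_goals exact Finset.mem_Iio.1 β.2

/-- The orthonormal polynomials `φ_α = Φ_α / ‖Φ_α‖_μ`. -/
noncomputable def orthonormalPoly (μ : Measure (Sphere d)) (α : MultiIndex d) :
    MvPolynomial (Fin d) ℂ :=
  (((Real.sqrt (polyInner μ (monicOP μ α) (monicOP μ α)).re)⁻¹ : ℝ) : ℂ) • monicOP μ α

/-- The Christoffel approximate `λ_n(z; dμ) = (∑_{0 ≼ α ≼ α(n)} |φ_α(z)|²)⁻¹`. -/
noncomputable def christoffelApprox (μ : Measure (Sphere d)) (n : ℕ)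
    (z : EuclideanSpace ℂ (Fin d)) : ℝ :=
  (∑ α ∈ Finset.Iic (MultiIndex.last n : MultiIndex d),
    ‖polyEval (orthonormalPoly μ α) z‖ ^ 2)⁻¹

/-- The Christoffel function `λ_∞(z; dμ) = lim_{n → ∞} λ_n(z; dμ)`. -/
noncomputable def christoffelFunction (μ : Measure (Sphere d))
    (z : EuclideanSpace ℂ (Fin d)) : ℝ :=
  limUnder atTop fun n => christoffelApprox μ n z

/-! ### Bounded holomorphic functions on the ball and their boundary values -/

/-- `f ∈ H^∞(𝔹ᵈ)`: `f` is holomorphic and bounded on the open unit ball (its values elsewhere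
are irrelevant). -/
def IsHInfty (f : EuclideanSpace ℂ (Fin d) → ℂ) : Prop :=
  DifferentiableOn ℂ f (Metric.ball 0 1) ∧ ∃ C : ℝ, ∀ z ∈ Metric.ball 0 1, ‖f z‖ ≤ C

/-- The Korányi approach region
`D_a(ζ) = {z ∈ 𝔹ᵈ : |1 - ⟨z, ζ⟩| < (a / 2) (1 - |z|²)}`. -/
def koranyiRegion (a : ℝ) (ζ : EuclideanSpace ℂ (Fin d)) : Set (EuclideanSpace ℂ (Fin d)) :=
  {z | z ∈ Metric.ball 0 1 ∧ ‖1 - inner ℂ ζ z‖ < a / 2 * (1 - ‖z‖ ^ 2)}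

/-- `K-lim_{z → ζ} f(z) = c`: `f(z) → c` as `z → ζ` inside `D_a(ζ)`, for every `a > 1`. -/
def HasKLimit (f : EuclideanSpace ℂ (Fin d) → ℂ) (ζ : EuclideanSpace ℂ (Fin d)) (c : ℂ) : Prop :=
  ∀ a : ℝ, 1 < a → Tendsto f (𝓝[koranyiRegion a ζ] ζ) (𝓝 c)

open Classical in
/-- The boundary value `f(ζ)`, the K-limit of `f` at `ζ`. For `f ∈ H^∞(𝔹ᵈ)` it exists at
`σ`-almost every `ζ`. On the remaining null set, where the value is immaterial, the radial limit is
used (if that exists too, and a junk value otherwise). -/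
noncomputable def boundaryValue (f : EuclideanSpace ℂ (Fin d) → ℂ) (ζ : Sphere d) : ℂ :=
  if h : ∃ c, HasKLimit f ζ c then h.choose
  else limUnder (𝓝[<] (1 : ℝ)) fun r => f (r • (ζ : EuclideanSpace ℂ (Fin d)))

/-! ### The Szegő entropy -/

/-- The integral of an extended-real function, positive part minus negative part; it may be `-∞`. -/
noncomputable def eintegral {X : Type*} [MeasurableSpace X] (ν : Measure X) (g : X → EReal) :
    EReal :=
  ((∫⁻ x, (g x).toENNReal ∂ν : ℝ≥0∞) : EReal) - ((∫⁻ x, (-g x).toENNReal ∂ν : ℝ≥0∞) : EReal)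

/-- `exp (∫ log w dσ)`, with `log 0 = -∞` and `exp (-∞) = 0`. -/
noncomputable def szegoEntropy (w : Sphere d → ℝ) : ℝ≥0∞ :=
  EReal.exp (eintegral (sigma d) fun ζ => ENNReal.log (ENNReal.ofReal (w ζ)))

end SzegoBall

/-!
The Christoffel approximate at the origin is the minimum of `∫ |p|² dμ` over the polynomials `p` of
degree at most `n` with `p(0) = 1` (`christoffelApprox_le`,
`exists_integral_eq_christoffelApprox`): expand `p` in the orthonormal polynomials and apply the
Cauchy–Schwarz inequality; the minimiser is the normalised reproducing kernel at the origin. Hence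
the approximates decrease, and their limit is the infimum of `∫ |p|² dμ` over all polynomials with
`p(0) = 1`. It remains to bound this infimum from both sides.

**Lower bound** (`szegoEntropy_le_lintegral`). Jensen's inequality for the exponential gives
`∫ |p|² w dσ ≥ exp (∫ log w dσ + ∫ log |p|² dσ)`, and `∫ log |p|² dσ ≥ log |p(0)|² = 0`, because `σ`
is invariant under the rotations `ζ ↦ e^{it} ζ` and the one-variable Jensen inequality holds on
every circle `{e^{it} ζ}` (`integral_sigma_log_nonneg`). The proof has `log (|p|² + ε)` in place of
`log |p|²`, which makes all integrands continuous.

**Upper bound** (`ofReal_christoffelFunction_le_lintegral`). Let `f` be bounded and holomorphic with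
`f(0) = 1`. For `r < 1` the dilation `z ↦ f(r z)` is a uniform limit of polynomials on the closed
ball (`exists_polynomial_approx`), so `∫ |f(r ζ)|² dμ(ζ)` bounds the infimum. As `r → 1`, the
absolutely continuous part tends to `∫ |f|² w dσ` by Fatou's theorem and dominated convergence
(`tendsto_lintegral_dilation`); only radial limits are needed, since a radial limit agrees with the
K-limit where the latter exists. To remove the singular part, choose a finite set `T` that carries
almost all its mass and multiply `f` by the product of the functions `(1 - ⟨z, τ⟩) / (1 - s ⟨z, τ⟩)`
over `τ ∈ T`. This product is one at the origin, vanishes on `T` and is bounded by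
`(2 / (1 + s)) ^ |T|`, which tends to one as `s → 1`.

Fatou's theorem is proved on the disc (`ae_exists_tendsto_radial`) and transferred to the ball along
slices (`ae_sigma_exists_tendsto_radial`). A primitive of a bounded holomorphic function is
Lipschitz, so that it is differentiable along the circle almost everywhere, by Rademacher's theorem.
At such a point, Cauchy's formula for the derivative of the primitive, with the kernel corrected by
that of the reflected point, is controlled by the Poisson kernel and yields the radial limit.
-/

namespace SzegoBall

variable {d : ℕ}

/-! ### Fatou's theorem on the unit disc -/

open Metric Real in
/-- Cauchy's formula for the derivative, with the kernel of the reflected point `1 / r` subtracted.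
The correction integrates to zero, and it improves the decay of the kernel to that of the Poisson
kernel divided by the distance to the boundary point `1`. -/
theorem deriv_eq_circleAverage_reflected {K : ℂ → ℂ} (hK : DiffContOnCl ℂ K (ball 0 1)) {r : ℝ}
    (hr0 : 0 < r) (hr1 : r < 1) :
    deriv K r = circleAverage
      (fun z => (z / (z - r) ^ 2 - z / (z - (r : ℂ)⁻¹) ^ 2) * K z) 0 1 := by
  have hrmem : (r : ℂ) ∈ ball (0 : ℂ) 1 := by simp [abs_of_pos hr0, hr1]
  have hne : ∀ z ∈ sphere (0 : ℂ) 1, z - r ≠ 0 := by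
    intro z hz h
    have : z = r := sub_eq_zero.1 h
    subst this
    simp [abs_of_pos hr0] at hz
    linarith
  have hne' : ∀ z ∈ closedBall (0 : ℂ) 1, z - (r : ℂ)⁻¹ ≠ 0 := by
    intro z hz h
    have : z = (r : ℂ)⁻¹ := sub_eq_zero.1 h
    subst this
    simp only [mem_closedBall, dist_zero_right, norm_inv, Complex.norm_real, norm_eq_abs,
      abs_of_pos hr0] at hz
    have := (one_lt_inv₀ hr0).2 hr1
    linarith
  have hcont : ContinuousOn K (sphere 0 1) := by
    refine hK.continuousOn.mono ?_
    rw [closure_ball _ one_ne_zero]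
    exact sphere_subset_closedBall
  have hq : DiffContOnCl ℂ (dslope K r) (ball 0 1) := by
    refine ⟨(Complex.differentiableOn_dslope (isOpen_ball.mem_nhds hrmem)).2 hK.differentiableOn,
      ?_⟩
    refine (continuousOn_dslope (mem_of_superset (isOpen_ball.mem_nhds hrmem)
      subset_closure)).2 ⟨hK.continuousOn, ?_⟩
    exact hK.differentiableAt isOpen_ball hrmem
  have h1 := (show DiffContOnCl ℂ (dslope K r) (ball 0 |(1 : ℝ)|) by
    rwa [abs_one]).circleAverage_smul_div (w := (r : ℂ))
      (by simpa using hrmem)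
  rw [dslope_same] at h1
  have h2 : circleAverage (fun z => z / (z - (r : ℂ)⁻¹) ^ 2 * K z) 0 1 = 0 := by
    have : DiffContOnCl ℂ (fun z => z / (z - (r : ℂ)⁻¹) ^ 2 * K z) (ball 0 |(1 : ℝ)|) := by
      rw [abs_one]
      refine DiffContOnCl.mk ?_ ?_
      · refine DifferentiableOn.mul (DifferentiableOn.div differentiableOn_id (by fun_prop) ?_)
          hK.differentiableOn
        intro z hz
        exact pow_ne_zero _ (hne' z (ball_subset_closedBall hz))
      · have h := hK.continuousOn
        rw [closure_ball _ one_ne_zero] at h ⊢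
        refine ContinuousOn.mul (ContinuousOn.div continuousOn_id (by fun_prop) ?_) h
        intro z hz
        exact pow_ne_zero _ (hne' z hz)
    rw [this.circleAverage]
    simp
  have h3 : circleAverage (fun z => z / (z - (r : ℂ)) ^ 2) 0 1 = 0 := by
    rw [circleAverage_eq_circleIntegral one_ne_zero]
    have h := circleIntegral.integral_sub_zpow_of_ne (n := -2) (by norm_num) 0 (r : ℂ) 1
    rw [circleIntegral.integral_congr (g := fun z => (z - (r : ℂ)) ^ (-2 : ℤ)) zero_le_one, h,
      smul_zero]
    intro z hz
    have hz0 : z ≠ 0 := by rintro rfl; simp at hz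
    have := hne z hz
    simp only [sub_zero, smul_eq_mul, zpow_neg]
    field_simp
  have ci1 : CircleIntegrable (fun z => z / (z - (r : ℂ)) ^ 2 * K z) 0 1 := by
    refine ContinuousOn.circleIntegrable zero_le_one ?_
    refine ContinuousOn.mul (ContinuousOn.div continuousOn_id (by fun_prop) ?_) hcont
    exact fun z hz => pow_ne_zero _ (hne z hz)
  have ci2 : CircleIntegrable (fun z => z / (z - (r : ℂ)⁻¹) ^ 2 * K z) 0 1 := by
    refine ContinuousOn.circleIntegrable zero_le_one ?_
    refine ContinuousOn.mul (ContinuousOn.div continuousOn_id (by fun_prop) ?_) hcont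
    exact fun z hz => pow_ne_zero _ (hne' z (sphere_subset_closedBall hz))
  have ci3 : CircleIntegrable (fun z => z / (z - (r : ℂ)) ^ 2) 0 1 := by
    refine ContinuousOn.circleIntegrable zero_le_one ?_
    refine ContinuousOn.div continuousOn_id (by fun_prop) ?_
    exact fun z hz => pow_ne_zero _ (hne z hz)
  have ci4 : CircleIntegrable (fun z => K r • (z / (z - (r : ℂ)) ^ 2)) 0 1 := ci3.const_fun_smul
  have e1 : circleAverage (fun z => z / (z - (r : ℂ)) ^ 2 * K z) 0 1 = deriv K r := by
    rw [← h1]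
    have e : circleAverage (fun z => ((z - 0) / (z - r)) • dslope K r z) 0 1
        = circleAverage (fun z => z / (z - (r : ℂ)) ^ 2 * K z - K r • (z / (z - (r : ℂ)) ^ 2)) 0 1
        := by
      refine circleAverage_congr_sphere ?_
      intro z hz
      rw [abs_one] at hz
      have hz' := hne z hz
      simp only
      rw [dslope_of_ne _ (sub_ne_zero.1 hz'), slope_def_field]
      simp only [sub_zero, smul_eq_mul]
      field_simp
    rw [e, circleAverage_fun_sub ci1 ci4, circleAverage_fun_smul, h3]
    simp
  simp_rw [sub_mul]
  rw [circleAverage_fun_sub ci1 ci2, e1, h2, sub_zero]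

open Metric Real in
/-- The two kernels of `deriv_eq_circleAverage_reflected` have the same modulus on the circle up to
the factor `r²`, and their difference gains the factor `2 (1 - r²) / |z - r|`. As the distance of
`z` to the boundary point `1` is at most `2 |z - r|`, this yields a bound by the Poisson kernel. -/
theorem norm_reflected_kernel_mul_le {r : ℝ} (hr0 : 0 < r) (hr1 : r < 1) {z : ℂ} (hz : ‖z‖ = 1) :
    ‖z / (z - r) ^ 2 - z / (z - (r : ℂ)⁻¹) ^ 2‖ * ‖z - 1‖ ≤ 4 * poissonKernel 0 r z := by
  have hrc : (r : ℂ) ≠ 0 := by exact_mod_cast hr0.ne'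
  set n := ‖z - r‖ with hn
  have hn1 : 1 - r ≤ n := by
    have := norm_sub_norm_le z r
    rw [hz, Complex.norm_real, norm_eq_abs, abs_of_pos hr0] at this
    exact this
  have hn0 : 0 < n := by linarith
  have hz1 : ‖z - 1‖ ≤ 2 * n := by
    have : z - 1 = (z - r) - ((1 - r : ℝ) : ℂ) := by push_cast; ring
    rw [this]
    refine (norm_sub_le _ _).trans ?_
    rw [Complex.norm_real, norm_eq_abs, abs_of_pos (by linarith)]
    linarith
  -- `z - 1 / r` is the reflection of `z - r`, up to a factor of modulus `1 / r`
  have hb : ‖z * r - 1‖ = n := by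
    have hzz : z * (starRingEnd ℂ) z = 1 := by
      rw [Complex.mul_conj, Complex.normSq_eq_norm_sq, hz]; simp
    have : z * r - 1 = -(z * (starRingEnd ℂ) (z - r)) := by
      rw [map_sub, Complex.conj_ofReal, mul_sub, hzz]; ring
    rw [this, norm_neg, norm_mul, hz, one_mul, RCLike.norm_conj]
  have hzr : z - r ≠ 0 := norm_pos_iff.1 hn0
  have hzr' : z * r - 1 ≠ 0 := norm_pos_iff.1 (by rw [hb]; exact hn0)
  have hzi : z - (r : ℂ)⁻¹ = (z * r - 1) / r := by field_simp
  have key : z / (z - r) ^ 2 - z / (z - (r : ℂ)⁻¹) ^ 2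
      = -(z * ((1 - r ^ 2 : ℝ) : ℂ) * ((z - r) * r + (z * r - 1))) /
        ((z - r) ^ 2 * (z * r - 1) ^ 2) := by
    rw [hzi, div_pow, div_div_eq_mul_div, div_sub_div _ _ (pow_ne_zero 2 hzr) (pow_ne_zero 2 hzr')]
    congr 1
    push_cast
    ring
  have hsum : ‖(z - r) * r + (z * r - 1)‖ ≤ 2 * n := by
    refine (norm_add_le _ _).trans ?_
    rw [hb, norm_mul, Complex.norm_real, norm_eq_abs, abs_of_pos hr0]
    nlinarith
  have h1r : 0 < 1 - r ^ 2 := by nlinarith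
  have hP : poissonKernel 0 r z = (1 - r ^ 2) / n ^ 2 := by
    rw [poissonKernel_def]
    simp [hz, hn]
  rw [hP, key, norm_div, norm_neg, norm_mul, norm_mul, norm_mul, norm_pow, norm_pow, hb, ← hn, hz,
    Complex.norm_real, norm_eq_abs, abs_of_pos h1r, div_mul_eq_mul_div,
    div_le_iff₀ (by positivity)]
  have : 4 * ((1 - r ^ 2) / n ^ 2) * (n ^ 2 * n ^ 2) = (1 - r ^ 2) * (2 * n) * (2 * n) := by
    field_simp
    ring
  rw [this, one_mul]
  gcongr

open Metric Real in
theorem circleAverage_eq_integral_Ioc {E : Type*} [NormedAddCommGroup E] [NormedSpace ℝ E]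
    (f : ℂ → E) :
    circleAverage f 0 1 = (2 * π)⁻¹ • ∫ t in Set.Ioc (-π) π, f (circleMap 0 1 t) := by
  rw [circleAverage_eq_integral_add (-π),
    intervalIntegral.integral_comp_add_right (fun t => f (circleMap 0 1 t)),
    intervalIntegral.integral_of_le (by linarith [pi_pos])]
  norm_num
  ring_nf

open Metric Real in
/-- The Poisson kernels `P_r` are an approximate identity at the boundary point `1`. -/
theorem tendsto_integral_poissonKernel {h : ℝ → ℝ} (hint : IntegrableOn h (Set.Ioc (-π) π))
    (h0 : Tendsto h (𝓝 0) (𝓝 0)) :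
    Tendsto (fun r : ℝ => ∫ t in Set.Ioc (-π) π,
      ((2 * π)⁻¹ * poissonKernel 0 r (circleMap 0 1 t)) * h t) (𝓝[<] 1) (𝓝 0) := by
  have hlt : ∀ᶠ r : ℝ in 𝓝[<] 1, 0 < r ∧ r < 1 := by
    filter_upwards [Ioo_mem_nhdsLT (show (0 : ℝ) < 1 by norm_num)] with r hr using hr
  have hmem : Set.Ioc (-π) π ∈ 𝓝 (0 : ℝ) := Ioc_mem_nhds (by linarith [pi_pos]) pi_pos
  have hformula : ∀ (r t : ℝ), poissonKernel 0 r (circleMap 0 1 t)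
      = (1 - r ^ 2) / ‖circleMap 0 1 t - r‖ ^ 2 := by
    intro r t
    rw [poissonKernel_def]
    simp
  refine tendsto_setIntegral_peak_smul_of_integrableOn_of_tendsto (x₀ := (0 : ℝ))
    measurableSet_Ioc measurableSet_Ioc subset_rfl
    (mem_of_superset self_mem_nhdsWithin subset_rfl) (by simp) ?_ ?_ ?_ ?_ hint
    (h0.mono_left nhdsWithin_le_nhds)
  · filter_upwards [hlt] with r hr t _
    rw [hformula]
    have : 0 ≤ 1 - r ^ 2 := by nlinarith
    positivity
  · intro u hu hu0
    obtain ⟨δ, hδ, hδu⟩ : ∃ δ > 0, ∀ t ∈ Set.Ioc (-π) π \ u, δ ≤ ‖circleMap 0 1 t - 1‖ := by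
      have hcpt : IsCompact (Set.Icc (-π) π \ u) := isCompact_Icc.diff hu
      rcases (Set.Icc (-π) π \ u).eq_empty_or_nonempty with he | hne
      · refine ⟨1, one_pos, fun t ht => ?_⟩
        exact absurd (show t ∈ Set.Icc (-π) π \ u from ⟨Set.Ioc_subset_Icc_self ht.1, ht.2⟩)
          (by simp [he])
      · obtain ⟨t₁, ht₁, hmin⟩ := hcpt.exists_isMinOn hne
          (f := fun t => ‖circleMap 0 1 t - 1‖) (by fun_prop)
        refine ⟨‖circleMap 0 1 t₁ - 1‖, norm_pos_iff.2 ?_, fun t ht =>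
          hmin ⟨Set.Ioc_subset_Icc_self ht.1, ht.2⟩⟩
        intro h
        have h1 : Complex.exp (t₁ * Complex.I) = 1 := by
          simpa [circleMap, sub_eq_zero] using h
        obtain ⟨n, hn⟩ := Complex.exp_eq_one_iff.1 h1
        have h2 : t₁ = n * (2 * π) := by
          have : (t₁ : ℂ) = n * (2 * π) := by
            apply mul_right_cancel₀ Complex.I_ne_zero
            rw [hn]; ring
          exact_mod_cast this
        have hn0 : n = 0 := by
          have h3 := ht₁.1.1
          have h4 := ht₁.1.2
          rw [h2] at h3 h4
          have a1 : (n : ℝ) < 1 := by nlinarith [pi_pos]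
          have a2 : (-1 : ℝ) < n := by nlinarith [pi_pos]
          have b1 : n < 1 := by exact_mod_cast a1
          have b2 : -1 < n := by exact_mod_cast a2
          omega
        rw [hn0] at h2
        simp only [Int.cast_zero, zero_mul] at h2
        exact ht₁.2 (h2 ▸ hu0)
    rw [Metric.tendstoUniformlyOn_iff]
    intro ε hε
    have hlim : Tendsto (fun r : ℝ => (2 * π)⁻¹ * ((1 - r ^ 2) / (δ / 2) ^ 2)) (𝓝[<] 1) (𝓝 0) := by
      have : Tendsto (fun r : ℝ => (2 * π)⁻¹ * ((1 - r ^ 2) / (δ / 2) ^ 2)) (𝓝 1)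
          (𝓝 ((2 * π)⁻¹ * ((1 - 1 ^ 2) / (δ / 2) ^ 2))) := by
        apply Continuous.tendsto
        fun_prop
      simpa using this.mono_left nhdsWithin_le_nhds
    have hclose : ∀ᶠ r : ℝ in 𝓝[<] 1, 1 - δ / 2 < r :=
      nhdsWithin_le_nhds (Ioi_mem_nhds (by linarith))
    filter_upwards [hlt, hlim.eventually (gt_mem_nhds hε), hclose] with r hr hr2 hr3 t ht
    have hdist : δ / 2 ≤ ‖circleMap 0 1 t - r‖ := by
      have h1 := hδu t ht
      have h2 : circleMap 0 1 t - 1 = (circleMap 0 1 t - r) - ((1 - r : ℝ) : ℂ) := by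
        push_cast; ring
      have h3 := norm_sub_le (circleMap 0 1 t - r) ((1 - r : ℝ) : ℂ)
      rw [← h2, Complex.norm_real, norm_eq_abs, abs_of_pos (by linarith)] at h3
      linarith
    have h1r : 0 ≤ 1 - r ^ 2 := by nlinarith
    simp only [Pi.zero_apply, dist_zero_left]
    rw [hformula, norm_eq_abs, abs_of_nonneg (by positivity)]
    refine lt_of_le_of_lt ?_ hr2
    gcongr
  · refine tendsto_const_nhds.congr' ?_
    filter_upwards [hlt] with r hr
    have h := (diffContOnCl_const (c := (1 : ℂ)) (s := ball (0 : ℂ) 1)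
      (𝕜 := ℂ)).circleAverage_poissonKernel_smul (w := (r : ℂ)) (by simp [abs_of_pos hr.1, hr.2])
    rw [circleAverage_eq_integral_Ioc] at h
    have h2 : ∫ t in Set.Ioc (-π) π, (poissonKernel 0 (r : ℂ) • fun _ => (1 : ℂ)) (circleMap 0 1 t)
        = ((∫ t in Set.Ioc (-π) π, poissonKernel 0 (r : ℂ) (circleMap 0 1 t) : ℝ) : ℂ) := by
      rw [← integral_complex_ofReal]
      refine integral_congr_ae (Eventually.of_forall fun t => ?_)
      simp
    rw [h2] at h
    rw [integral_const_mul]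
    have h3 : (((2 * π)⁻¹ * ∫ t in Set.Ioc (-π) π, poissonKernel 0 (r : ℂ) (circleMap 0 1 t) : ℝ) : ℂ)
        = 1 := by
      rw [← h]; simp
    exact_mod_cast h3.symm
  · filter_upwards [hlt] with r hr
    refine Measurable.aestronglyMeasurable ?_
    simp_rw [hformula]
    fun_prop

open Metric Real in
/-- If a function that is continuous on the closed disc and holomorphic inside has a derivative
along the circle at the boundary point `1`, then its complex derivative has a radial limit there. -/
theorem exists_tendsto_deriv_of_hasDerivAt_circle {G : ℂ → ℂ} (hd : DifferentiableOn ℂ G (ball 0 1))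
    (hc : Continuous G) {B : ℂ} (hB : HasDerivAt (fun t : ℝ => G (circleMap 0 1 t)) B 0)
    {M : ℝ} (hM : ∀ z, ‖G z - G 1‖ ≤ M * ‖z - 1‖) :
    ∃ c, Tendsto (fun r : ℝ => deriv G r) (𝓝[<] 1) (𝓝 c) := by
  -- `A` is the candidate for the limit, and `K` is the error of first order of `G` at `1`
  set A : ℂ := B / Complex.I with hA
  set K : ℂ → ℂ := fun z => G z - G 1 - A * (z - 1) with hK
  set h : ℝ → ℝ := fun t => ‖K (circleMap 0 1 t)‖ / ‖circleMap 0 1 t - 1‖ with hh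
  have hlt : ∀ᶠ r : ℝ in 𝓝[<] 1, 0 < r ∧ r < 1 := by
    filter_upwards [Ioo_mem_nhdsLT (show (0 : ℝ) < 1 by norm_num)] with r hr using hr
  have hKc : Continuous K := by fun_prop
  have hKd : DiffContOnCl ℂ K (ball 0 1) := by
    refine DiffContOnCl.mk ?_ hKc.continuousOn
    exact (hd.sub_const _).sub (by fun_prop)
  have hexp : HasDerivAt (fun t : ℝ => circleMap 0 1 t) Complex.I 0 := by
    have := hasDerivAt_circleMap 0 1 0
    rwa [show circleMap 0 1 0 * Complex.I = Complex.I by simp [circleMap]] at this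
  have hbd : ∀ t, ‖h t‖ ≤ M + ‖A‖ := by
    intro t
    rw [hh, norm_eq_abs, abs_of_nonneg (by positivity)]
    rcases eq_or_ne (circleMap 0 1 t) 1 with h1 | h1
    · simp only [h1, sub_self, norm_zero, div_zero]
      have := (norm_nonneg _).trans (hM 2)
      norm_num at this
      positivity
    · rw [div_le_iff₀ (norm_pos_iff.2 (sub_ne_zero.2 h1))]
      refine (norm_sub_le _ _).trans ?_
      rw [norm_mul, add_mul]
      gcongr
      exact hM _
  have hmeas : Measurable h := by
    have : Measurable fun t => K (circleMap 0 1 t) := by fun_prop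
    fun_prop
  have hint : IntegrableOn h (Set.Ioc (-π) π) := by
    refine Measure.integrableOn_of_bounded (M := M + ‖A‖) (by simp) hmeas.aestronglyMeasurable ?_
    exact Eventually.of_forall hbd
  have hlim : Tendsto h (𝓝 0) (𝓝 0) := by
    have h1 : HasDerivAt (fun t : ℝ => K (circleMap 0 1 t)) 0 0 := by
      have := (hB.sub_const (G 1)).sub ((hexp.sub_const 1).const_mul A)
      convert! this using 1
      rw [hA, div_mul_cancel₀ _ Complex.I_ne_zero, sub_self]
    have h2 : (fun t : ℝ => K (circleMap 0 1 t)) =o[𝓝 0] fun t => t := by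
      have := hasDerivAt_iff_isLittleO.1 h1
      have h0 : K (circleMap 0 1 0) = 0 := by simp [hK, circleMap]
      simpa [h0] using this
    have h3 : (fun t : ℝ => t) =O[𝓝 0] fun t => circleMap 0 1 t - 1 := by
      have := (HasDerivAtFilter.isTheta_sub hexp Complex.I_ne_zero).isBigO_symm
      have h4 := this.comp_tendsto (tendsto_id (α := ℝ) (x := 𝓝 0) |>.prodMk tendsto_const_pure)
      simpa [Function.comp_def, circleMap] using h4
    exact (h2.trans_isBigO h3).norm_norm.tendsto_div_nhds_zero
  refine ⟨A, tendsto_iff_norm_sub_tendsto_zero.2 ?_⟩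
  have hP := (tendsto_integral_poissonKernel hint hlim).const_mul 4
  rw [mul_zero] at hP
  refine squeeze_zero' (Eventually.of_forall fun _ => norm_nonneg _) ?_ hP
  filter_upwards [hlt] with r hr
  have hrmem : (r : ℂ) ∈ ball (0 : ℂ) 1 := by simp [abs_of_pos hr.1, hr.2]
  have hder : deriv K r = deriv G r - A := by
    have h1 := (hd.differentiableAt (isOpen_ball.mem_nhds hrmem)).hasDerivAt
    have h2 := (h1.sub_const (G 1)).sub (((hasDerivAt_id (r : ℂ)).sub_const 1).const_mul A)
    simpa using! h2.deriv
  rw [← hder, deriv_eq_circleAverage_reflected hKd hr.1 hr.2, circleAverage_eq_integral_Ioc,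
    norm_smul, norm_eq_abs, abs_of_pos (by positivity), ← integral_const_mul]
  rw [show (∫ t in Set.Ioc (-π) π, 4 * ((2 * π)⁻¹ * poissonKernel 0 (r : ℂ) (circleMap 0 1 t) * h t))
      = (2 * π)⁻¹ * ∫ t in Set.Ioc (-π) π, 4 * poissonKernel 0 (r : ℂ) (circleMap 0 1 t) * h t by
    rw [← integral_const_mul]; congr 1; ext t; ring]
  refine mul_le_mul_of_nonneg_left (norm_integral_le_of_norm_le ?_ ?_) (by positivity)
  · rw [← integrableOn_Icc_iff_integrableOn_Ioc] at hint
    rw [← IntegrableOn, ← integrableOn_Icc_iff_integrableOn_Ioc]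
    refine IntegrableOn.continuousOn_mul ?_ hint isCompact_Icc
    refine Continuous.continuousOn (continuous_const.mul ?_)
    have hne : ∀ t, ‖circleMap 0 1 t - r‖ ^ 2 ≠ 0 := by
      intro t h
      have h1 : circleMap 0 1 t = r := by simpa [sub_eq_zero] using h
      have h2 := congrArg norm h1
      rw [Complex.norm_real, norm_eq_abs, abs_of_pos hr.1] at h2
      simp at h2
      linarith [hr.2]
    simp only [poissonKernel_def, sub_zero]
    exact Continuous.div (by fun_prop) (by fun_prop) hne
  · refine Eventually.of_forall fun t => ?_
    rcases eq_or_ne (circleMap 0 1 t) 1 with h1 | h1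
    · simp [h1, hK, hh]
    · have h2 : 0 < ‖circleMap 0 1 t - 1‖ := norm_pos_iff.2 (sub_ne_zero.2 h1)
      have h3 := norm_reflected_kernel_mul_le hr.1 hr.2 (z := circleMap 0 1 t) (by simp)
      rw [norm_mul]
      have h4 : ‖K (circleMap 0 1 t)‖ = ‖circleMap 0 1 t - 1‖ * h t := by
        rw [hh]; field_simp
      rw [h4, ← mul_assoc]
      gcongr

open Metric Real in
/-- **Fatou's theorem**: a bounded holomorphic function on the unit disc has radial limits almost
everywhere. -/
theorem ae_exists_tendsto_radial {g : ℂ → ℂ} (hg : DifferentiableOn ℂ g (ball 0 1)) {C : ℝ}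
    (hC : ∀ z ∈ ball (0 : ℂ) 1, ‖g z‖ ≤ C) :
    ∀ᵐ t : ℝ, ∃ c, Tendsto (fun r : ℝ => g (r * circleMap 0 1 t)) (𝓝[<] 1) (𝓝 c) := by
  -- a primitive of `g` is Lipschitz, hence differentiable along the circle almost everywhere
  obtain ⟨F, hF⟩ := hg.isExactOn_ball
  have hlip : LipschitzOnWith C.toNNReal F (ball 0 1) := by
    refine (convex_ball _ _).lipschitzOnWith_of_nnnorm_hasDerivWithin_le
      (fun z hz => (hF z hz).hasDerivWithinAt) fun z hz => ?_
    rw [← NNReal.coe_le_coe, coe_nnnorm]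
    exact (hC z hz).trans (le_coe_toNNReal C)
  obtain ⟨F₁, hF₁, heq⟩ := hlip.extend_finite_dimension
  have hderiv : ∀ z ∈ ball (0 : ℂ) 1, HasDerivAt F₁ (g z) z := fun z hz =>
    (hF z hz).congr_of_eventuallyEq
      (mem_of_superset (isOpen_ball.mem_nhds hz) fun w hw => (heq hw).symm)
  have hΦ := (hF₁.comp (lipschitzWith_circleMap 0 1)).ae_differentiableAt_real
  filter_upwards [hΦ] with t ht
  set ζ := circleMap 0 1 t with hζ
  have hζ1 : ‖ζ‖ = 1 := by simp [hζ]
  have hζ0 : ζ ≠ 0 := norm_pos_iff.1 (by rw [hζ1]; exact one_pos)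
  -- rotate the point of differentiability to `1`
  have hball : ∀ z ∈ ball (0 : ℂ) 1, ζ * z ∈ ball (0 : ℂ) 1 := by
    intro z hz
    simpa [hζ1] using hz
  have hG : ∀ z ∈ ball (0 : ℂ) 1, HasDerivAt (fun z => F₁ (ζ * z) / ζ) (g (ζ * z)) z := by
    intro z hz
    have h1 := ((hderiv _ (hball z hz)).comp z ((hasDerivAt_id z).const_mul ζ)).div_const ζ
    convert! h1 using 1
    field_simp
  obtain ⟨c, hc⟩ := exists_tendsto_deriv_of_hasDerivAt_circle (G := fun z => F₁ (ζ * z) / ζ)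
    (B := deriv (F₁ ∘ circleMap 0 1) t / ζ)
    (M := (lipschitzExtensionConstant ℂ * C.toNNReal : NNReal))
    (fun z hz => (hG z hz).differentiableAt.differentiableWithinAt)
    ((hF₁.continuous.comp (by fun_prop)).div_const ζ)
    (by
      have h1 : HasDerivAt (fun s : ℝ => (F₁ ∘ circleMap 0 1) (t + s))
          (deriv (F₁ ∘ circleMap 0 1) t) 0 :=
        HasDerivAt.comp_const_add t 0 (by simpa using ht.hasDerivAt)
      convert! h1.div_const ζ using 2 with s
      simp [hζ, circleMap, add_mul, Complex.exp_add])
    (by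
      intro z
      rw [← sub_div, norm_div, hζ1, div_one]
      refine (hF₁.norm_sub_le _ _).trans ?_
      rw [← mul_sub, norm_mul, hζ1, one_mul])
  refine ⟨c, hc.congr' ?_⟩
  filter_upwards [Ioo_mem_nhdsLT (show (0 : ℝ) < 1 by norm_num)] with r hr
  rw [(hG r (by simp [abs_of_pos hr.1, hr.2])).deriv, mul_comm]

/-! ### Holomorphic functions of several variables -/

open Metric in
/-- Cauchy's estimate for the Fréchet derivative. -/
theorem norm_fderiv_le_of_forall_closedBall {E : Type*} [NormedAddCommGroup E] [NormedSpace ℂ E]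
    {f : E → ℂ} {w : E} {ε C : ℝ} (hε : 0 < ε)
    (hd : ∀ z ∈ closedBall w ε, DifferentiableAt ℂ f z) (hC : ∀ z ∈ closedBall w ε, ‖f z‖ ≤ C) :
    ‖fderiv ℂ f w‖ ≤ C / ε := by
  have hC0 : 0 ≤ C := (norm_nonneg _).trans (hC w (mem_closedBall_self hε.le))
  refine ContinuousLinearMap.opNorm_le_bound _ (by positivity) fun u => ?_
  rcases eq_or_ne u 0 with rfl | hu
  · simp
  have hu' : 0 < ‖u‖ := norm_pos_iff.2 hu
  have hin : ∀ l ∈ closedBall (0 : ℂ) (ε / ‖u‖), w + l • u ∈ closedBall w ε := by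
    intro l hl
    rw [mem_closedBall_zero_iff, le_div_iff₀ hu'] at hl
    simpa [norm_smul] using hl
  have hder : ∀ l ∈ closedBall (0 : ℂ) (ε / ‖u‖), DifferentiableAt ℂ (fun l : ℂ => f (w + l • u)) l :=
    fun l hl => (hd _ (hin l hl)).comp l (by fun_prop)
  have h1 : deriv (fun l : ℂ => f (w + l • u)) 0 = fderiv ℂ f w u := by
    have h2 : HasDerivAt (fun l : ℂ => w + l • u) u 0 := by
      simpa using ((hasDerivAt_id (0 : ℂ)).smul_const u).const_add w
    have h3 : HasFDerivAt f (fderiv ℂ f w) (w + (0 : ℂ) • u) := by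
      simpa using (hd w (mem_closedBall_self hε.le)).hasFDerivAt
    exact (h3.comp_hasDerivAt _ h2).deriv
  rw [← h1]
  have h2 := Complex.norm_deriv_le_of_forall_mem_sphere_norm_le (c := 0) (R := ε / ‖u‖) (C := C)
    (f := fun l : ℂ => f (w + l • u)) (by positivity)
    (DifferentiableOn.diffContOnCl_ball (U := closedBall 0 (ε / ‖u‖))
      (fun l hl => (hder l hl).differentiableWithinAt) subset_rfl)
    (fun l hl => hC _ (hin l (sphere_subset_closedBall hl)))
  rwa [div_div_eq_mul_div, mul_div_right_comm] at h2

open Metric Real in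
/-- Directional derivatives of a holomorphic function of several variables are holomorphic: they
are given by Cauchy's formula on a small circle in the given direction. -/
theorem differentiableOn_fderiv_apply {E : Type*} [NormedAddCommGroup E] [NormedSpace ℂ E]
    [FiniteDimensional ℂ E] {f : E → ℂ} {U : Set E} (hU : IsOpen U) (hf : DifferentiableOn ℂ f U)
    (v : E) : DifferentiableOn ℂ (fun z => fderiv ℂ f z v) U := by
  intro z₀ hz₀
  borelize E
  have : ProperSpace E := FiniteDimensional.proper ℂ E
  obtain ⟨R, hR, hRU⟩ := nhds_basis_closedBall.mem_iff.1 (hU.mem_nhds hz₀)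
  have hda : ∀ z ∈ closedBall z₀ R, DifferentiableAt ℂ f z := fun z hz =>
    hf.differentiableAt (hU.mem_nhds (hRU hz))
  obtain ⟨C, hC⟩ := (isCompact_closedBall z₀ R).exists_bound_of_continuousOn
    (hf.continuousOn.mono hRU)
  set ρ : ℝ := R / (4 * (‖v‖ + 1)) with hρ
  have hρ0 : 0 < ρ := by positivity
  have hρv : ρ * ‖v‖ ≤ R / 4 := by
    rw [hρ, div_mul_eq_mul_div, div_le_div_iff₀ (by positivity) (by norm_num)]
    nlinarith [norm_nonneg v]
  have hin : ∀ z ∈ ball z₀ (R / 4), ∀ l ∈ closedBall (0 : ℂ) ρ,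
      z + l • v ∈ closedBall z₀ (R / 2) := by
    intro z hz l hl
    rw [mem_ball_iff_norm] at hz
    rw [mem_closedBall_zero_iff] at hl
    rw [mem_closedBall_iff_norm, add_sub_right_comm]
    refine (norm_add_le _ _).trans ?_
    rw [norm_smul]
    have : ‖l‖ * ‖v‖ ≤ ρ * ‖v‖ := by gcongr
    linarith
  have hin' : ∀ w ∈ closedBall z₀ (R / 2), closedBall w (R / 2) ⊆ closedBall z₀ R := by
    intro w hw
    refine closedBall_subset_closedBall' ?_
    rw [mem_closedBall] at hw
    linarith
  have hsub : closedBall z₀ (R / 2) ⊆ closedBall z₀ R :=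
    closedBall_subset_closedBall (by linarith)
  have hcm : ∀ t, circleMap 0 ρ t ∈ closedBall (0 : ℂ) ρ := fun t =>
    circleMap_mem_closedBall 0 hρ0.le t
  have hcont : ∀ z ∈ ball z₀ (R / 4), Continuous fun t => f (z + circleMap 0 ρ t • v) := by
    intro z hz
    rw [continuous_iff_continuousAt]
    intro t
    exact ContinuousAt.comp (f := fun t => z + circleMap 0 ρ t • v)
      (hda _ (hsub (hin z hz _ (hcm t)))).continuousAt (by fun_prop)
  set k : ℝ → ℂ := fun t => deriv (circleMap 0 ρ) t * (1 / (circleMap 0 ρ t - 0) ^ 2) with hk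
  have hkc : Continuous k := by
    have : ∀ t, circleMap 0 ρ t - 0 ≠ 0 := fun t => by
      rw [sub_zero]; exact circleMap_ne_center hρ0.ne'
    simp only [hk, deriv_circleMap]
    refine Continuous.mul (by fun_prop) (Continuous.div (by fun_prop) (by fun_prop)
      fun t => pow_ne_zero 2 (this t))
  have hformula : ∀ z ∈ ball z₀ (R / 4), fderiv ℂ f z v =
      (2 * π * Complex.I : ℂ)⁻¹ • ∫ t in 0..2 * π, k t * f (z + circleMap 0 ρ t • v) := by
    intro z hz
    have hder : ∀ l ∈ closedBall (0 : ℂ) ρ,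
        DifferentiableAt ℂ (fun l : ℂ => f (z + l • v)) l := fun l hl =>
      (hda _ (hsub (hin z hz l hl))).comp l (by fun_prop)
    have h1 : deriv (fun l : ℂ => f (z + l • v)) 0 = fderiv ℂ f z v := by
      have h2 : HasDerivAt (fun l : ℂ => z + l • v) v 0 := by
        simpa using ((hasDerivAt_id (0 : ℂ)).smul_const v).const_add z
      have h3 : HasFDerivAt f (fderiv ℂ f z) (z + (0 : ℂ) • v) := by
        have := hin z hz 0 (by simp [hρ0.le])
        rw [zero_smul, add_zero] at this ⊢
        exact (hda z (hsub this)).hasFDerivAt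
      exact (h3.comp_hasDerivAt _ h2).deriv
    have h4 := DiffContOnCl.deriv_eq_smul_circleIntegral hρ0
      (DifferentiableOn.diffContOnCl_ball (U := closedBall 0 ρ)
        (fun l hl => (hder l hl).differentiableWithinAt) subset_rfl)
    rw [← h1, eq_inv_smul_iff₀ Complex.two_pi_I_ne_zero, ← h4]
    simp only [circleIntegral, hk, smul_eq_mul, mul_assoc]
  have hmain : HasFDerivAt (fun z => ∫ t in 0..2 * π, k t * f (z + circleMap 0 ρ t • v))
      (∫ t in 0..2 * π, k t • fderiv ℂ f (z₀ + circleMap 0 ρ t • v)) z₀ := by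
    have hs : ball z₀ (R / 4) ∈ 𝓝 z₀ := ball_mem_nhds _ (by positivity)
    refine intervalIntegral.hasFDerivAt_integral_of_dominated_of_fderiv_le (𝕜 := ℂ)
      (F := fun z t => k t * f (z + circleMap 0 ρ t • v))
      (F' := fun z t => k t • fderiv ℂ f (z + circleMap 0 ρ t • v))
      (bound := fun t => ‖k t‖ * (C / (R / 2))) hs ?_ ?_ ?_ ?_ ?_ ?_
    · filter_upwards [hs] with z hz
      exact (hkc.mul (hcont z hz)).aestronglyMeasurable
    · exact (hkc.mul (hcont z₀ (mem_of_mem_nhds hs))).intervalIntegrable _ _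
    · have h1 : Measurable fun t => fderiv ℂ f (z₀ + circleMap 0 ρ t • v) :=
        (measurable_fderiv ℂ f).comp (by fun_prop : Continuous _).measurable
      exact hkc.aestronglyMeasurable.smul h1.aestronglyMeasurable
    · refine Eventually.of_forall fun t _ z hz => ?_
      rw [norm_smul]
      gcongr
      have hw := hin z hz _ (hcm t)
      exact norm_fderiv_le_of_forall_closedBall (by positivity)
        (fun w h => hda w (hin' _ hw h)) (fun w h => hC w (hin' _ hw h))
    · exact (hkc.norm.mul continuous_const).intervalIntegrable _ _
    · refine Eventually.of_forall fun t _ z hz => ?_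
      have h1 := (hda _ (hsub (hin z hz _ (hcm t)))).hasFDerivAt
      have h2 : HasFDerivAt (fun z => z + circleMap 0 ρ t • v) (ContinuousLinearMap.id ℂ E) z :=
        (hasFDerivAt_id z).add_const _
      have h3 := (h1.comp z h2).const_mul (k t)
      simpa using! h3
  refine DifferentiableAt.differentiableWithinAt ?_
  refine (hmain.differentiableAt.const_smul ((2 * π * Complex.I : ℂ)⁻¹)).congr_of_eventuallyEq ?_
  filter_upwards [ball_mem_nhds z₀ (show 0 < R / 4 by positivity)] with z hz
  exact hformula z hz

/-- A complex differentiable function of several variables is smooth. -/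
theorem contDiffOn_of_differentiableOn {E : Type*} [NormedAddCommGroup E] [NormedSpace ℂ E]
    [FiniteDimensional ℂ E] {U : Set E} (hU : IsOpen U) (n : ℕ) :
    ∀ {f : E → ℂ}, DifferentiableOn ℂ f U → ContDiffOn ℂ n f U := by
  induction n with
  | zero => exact fun hf => contDiffOn_zero.2 hf.continuousOn
  | succ n ih =>
    intro f hf
    push_cast
    rw [contDiffOn_succ_iff_fderiv_apply hU.uniqueDiffOn]
    refine ⟨hf, by simp, fun v => ?_⟩
    refine (ih (differentiableOn_fderiv_apply hU hf v)).congr fun z hz => ?_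
    rw [fderivWithin_of_isOpen hU hz]

/-- A multilinear form restricted to the diagonal is a polynomial. -/
theorem exists_polyEval_eq_multilinear {k : ℕ}
    (D : MultilinearMap ℂ (fun _ : Fin k => EuclideanSpace ℂ (Fin d)) ℂ) :
    ∃ p : MvPolynomial (Fin d) ℂ, ∀ z, polyEval p z = D fun _ => z := by
  refine ⟨∑ s : Fin k → Fin d, MvPolynomial.C (D fun j => EuclideanSpace.basisFun (Fin d) ℂ (s j)) *
    ∏ j, MvPolynomial.X (s j), fun z => ?_⟩
  have hz : z = ∑ i, z i • EuclideanSpace.basisFun (Fin d) ℂ i := by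
    simpa using ((EuclideanSpace.basisFun (Fin d) ℂ).sum_repr z).symm
  conv_rhs => rw [hz]
  rw [D.map_sum]
  simp only [polyEval, map_sum, map_mul, MvPolynomial.eval_C, map_prod, MvPolynomial.eval_X,
    D.map_smul_univ, smul_eq_mul, mul_comm]

open Metric in
/-- The Taylor coefficients at the origin along complex lines are polynomials in the direction. -/
theorem exists_polyEval_eq_iteratedDeriv {f : EuclideanSpace ℂ (Fin d) → ℂ}
    (hf : DifferentiableOn ℂ f (ball 0 1)) (k : ℕ) :
    ∃ p : MvPolynomial (Fin d) ℂ, ∀ z,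
      polyEval p z = iteratedDeriv k (fun l : ℂ => f (l • z)) 0 := by
  obtain ⟨p, hp⟩ := exists_polyEval_eq_multilinear
    (iteratedFDeriv ℂ k f (0 : EuclideanSpace ℂ (Fin d))).toMultilinearMap
  refine ⟨p, fun z => ?_⟩
  rw [hp]
  set L : ℂ →L[ℂ] EuclideanSpace ℂ (Fin d) := ContinuousLinearMap.toSpanSingleton ℂ z with hL
  have ho : IsOpen (L ⁻¹' ball 0 1) := isOpen_ball.preimage L.continuous
  have h0 : (0 : ℂ) ∈ L ⁻¹' ball 0 1 := by simp
  have h1 := L.iteratedFDerivWithin_comp_right (contDiffOn_of_differentiableOn isOpen_ball k hf)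
    isOpen_ball.uniqueDiffOn ho.uniqueDiffOn (x := 0) h0 le_rfl
  rw [iteratedFDerivWithin_of_isOpen k ho h0,
    iteratedFDerivWithin_of_isOpen k isOpen_ball (by simp)] at h1
  have h2 : (fun l : ℂ => f (l • z)) = f ∘ L := by ext l; simp [hL]
  rw [h2, iteratedDeriv_eq_iteratedFDeriv, h1]
  simp [hL]

open Metric in
/-- The dilations of a bounded holomorphic function are uniform limits of polynomials on the closed
unit ball, by truncation of the homogeneous expansion. -/
theorem exists_polynomial_approx {f : EuclideanSpace ℂ (Fin d) → ℂ}
    (hf : DifferentiableOn ℂ f (ball 0 1)) {C : ℝ} (hC : ∀ z ∈ ball 0 1, ‖f z‖ ≤ C) {r : ℝ}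
    (hr0 : 0 < r) (hr1 : r < 1) {ε : ℝ} (hε : 0 < ε) :
    ∃ p : MvPolynomial (Fin d) ℂ, polyEval p 0 = f 0 ∧
      ∀ z, ‖z‖ ≤ 1 → ‖polyEval p z - f (r • z)‖ ≤ ε := by
  choose P hP using exists_polyEval_eq_iteratedDeriv hf
  -- Cauchy's estimates on the circle of radius `s` bound the terms by a geometric series
  obtain ⟨s, hrs, hs1⟩ := exists_between hr1
  have hs0 : 0 < s := hr0.trans hrs
  have hq1 : r / s < 1 := (div_lt_one hs0).2 hrs
  obtain ⟨N, hN⟩ : ∃ N : ℕ, C * (r / s) ^ (N + 1) / (1 - r / s) < ε := by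
    have : Tendsto (fun N : ℕ => C * (r / s) ^ (N + 1) / (1 - r / s)) atTop (𝓝 0) := by
      have h1 := ((tendsto_pow_atTop_nhds_zero_of_lt_one (by positivity) hq1).comp
        (tendsto_add_atTop_nat 1)).const_mul C |>.div_const (1 - r / s)
      simpa using h1
    exact (this.eventually (gt_mem_nhds hε)).exists
  have heval : ∀ z, polyEval (∑ k ∈ Finset.range (N + 1),
        MvPolynomial.C ((k.factorial : ℂ)⁻¹ * (r : ℂ) ^ k) * P k) z
      = ∑ k ∈ Finset.range (N + 1), (k.factorial : ℂ)⁻¹ • ((r : ℂ) - 0) ^ k •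
          iteratedDeriv k (fun l : ℂ => f (l • z)) 0 := by
    intro z
    simp only [← hP]
    simp [polyEval, mul_assoc]
  have hin : ∀ z : EuclideanSpace ℂ (Fin d), ‖z‖ ≤ 1 → ∀ l ∈ ball (0 : ℂ) 1, l • z ∈ ball 0 1 := by
    intro z hz l hl
    rw [mem_ball_zero_iff] at hl ⊢
    rw [norm_smul]
    nlinarith [norm_nonneg l, norm_nonneg z]
  have hdiff : ∀ z : EuclideanSpace ℂ (Fin d), ‖z‖ ≤ 1 →
      DifferentiableOn ℂ (fun l : ℂ => f (l • z)) (ball 0 1) := fun z hz =>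
    hf.comp (by fun_prop) (fun l hl => hin z hz l hl)
  have hsum : ∀ z : EuclideanSpace ℂ (Fin d), ‖z‖ ≤ 1 →
      ‖∑ k ∈ Finset.range (N + 1), (k.factorial : ℂ)⁻¹ • ((r : ℂ) - 0) ^ k •
          iteratedDeriv k (fun l : ℂ => f (l • z)) 0 - f ((r : ℂ) • z)‖ ≤ ε := by
    intro z hz
    have h1 := Complex.hasSum_taylorSeries_on_ball (hdiff z hz) (z := (r : ℂ))
      (by simp [abs_of_pos hr0, hr1])
    refine (norm_sub_le_of_geometric_bound_of_hasSum (C := C) hq1 (fun n => ?_) h1 (N + 1)).trans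
      hN.le
    have h2 := Complex.norm_iteratedDeriv_le_of_forall_mem_sphere_norm_le n hs0 (c := 0) (C := C)
      ((hdiff z hz).diffContOnCl_ball (closedBall_subset_ball hs1))
      (fun l hl => hC _ (hin z hz l (closedBall_subset_ball hs1 (sphere_subset_closedBall hl))))
    rw [norm_smul, norm_smul, norm_inv, norm_pow, sub_zero, Complex.norm_real, Complex.norm_natCast,
      Real.norm_eq_abs, abs_of_pos hr0]
    calc _ ≤ (n.factorial : ℝ)⁻¹ * (r ^ n * (n.factorial * C / s ^ n)) := by gcongr
      _ = C * (r / s) ^ n := by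
        have : (n.factorial : ℝ) ≠ 0 := by positivity
        rw [div_pow]
        field_simp
  refine ⟨∑ k ∈ Finset.range (N + 1), MvPolynomial.C ((k.factorial : ℂ)⁻¹ * (r : ℂ) ^ k) * P k,
    ?_, fun z hz => ?_⟩
  · rw [heval, Finset.sum_range_succ']
    simp [iteratedDeriv_const]
  · rw [heval]
    exact hsum z hz

/-! ### Orthonormal polynomials and the extremal problem -/

theorem MultiIndex.le_last (hd : 1 ≤ d) {α : MultiIndex d} {n : ℕ} (h : α.length ≤ n) :
    α ≤ MultiIndex.last n := by
  refine not_lt.1 fun hlt => ?_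
  have hlast : (MultiIndex.last n : MultiIndex d).length = n := by
    rw [length, Finset.sum_eq_single ⟨d - 1, by omega⟩]
    · simp [last, Nat.sub_add_cancel hd]
    · intro i _ hi
      have : (i : ℕ) + 1 ≠ d := fun h => hi (Fin.ext (by simp; omega))
      simp [last, this]
    · simp
  rcases MultiIndex.lt_iff.1 hlt with h1 | ⟨h1, i, hij, hi⟩
  · omega
  · -- the first difference sits at the last place, where the two entries are the lengths
    have hid : (i : ℕ) + 1 = d := by
      by_contra hne
      simp [last, hne] at hi
    have h2 : α.length = α.entry i := by
      rw [length]
      refine Finset.sum_eq_single i (fun j _ hji => ?_) (by simp)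
      have hlt : j < i := lt_of_le_of_ne (Fin.le_def.2 (by omega)) hji
      rw [← hij j hlt, last]
      have : (j : ℕ) + 1 ≠ d := by
        have := Fin.lt_def.1 hlt
        omega
      simp [this]
    simp only [last, hid, if_true] at hi
    omega

theorem MultiIndex.monotone_last (hd : 1 ≤ d) :
    Monotone (MultiIndex.last : ℕ → MultiIndex d) := by
  intro m n hmn
  refine le_last hd (le_trans ?_ hmn)
  rw [length]
  refine (Finset.sum_le_sum (g := fun i : Fin d => if i = ⟨d - 1, by omega⟩ then m else 0)
    fun i _ => ?_).trans (by simp)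
  simp only [last]
  split_ifs with h1 h2 h2
  · exact le_rfl
  · exact absurd (Fin.ext (by simp; omega)) h2
  · exact Nat.zero_le _
  · exact le_rfl

theorem mem_span_mono_of_totalDegree_le (hd : 1 ≤ d) (p : MvPolynomial (Fin d) ℂ) :
    p ∈ Submodule.span ℂ (mono '' Set.Iic (MultiIndex.last p.totalDegree : MultiIndex d)) := by
  suffices h : ∑ s ∈ p.support, MvPolynomial.monomial s (p.coeff s) ∈ Submodule.span ℂ
      (mono '' Set.Iic (MultiIndex.last p.totalDegree : MultiIndex d)) by
    rwa [← p.as_sum] at h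
  refine Submodule.sum_mem _ fun s hs => ?_
  have h1 : MvPolynomial.monomial s (p.coeff s) = p.coeff s • mono ⟨s⟩ := by
    rw [mono, MvPolynomial.monomial_eq, MvPolynomial.smul_eq_C_mul, Finsupp.prod_fintype]
    simp
  rw [h1]
  refine Submodule.smul_mem _ _ (Submodule.subset_span ⟨⟨s⟩, MultiIndex.le_last hd ?_, rfl⟩)
  have := MvPolynomial.le_totalDegree hs
  rwa [Finsupp.sum_fintype _ _ (fun _ => rfl)] at this

@[fun_prop]
theorem continuous_polyEval (p : MvPolynomial (Fin d) ℂ) : Continuous (polyEval p) :=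
  (MvPolynomial.continuous_eval p).comp (by fun_prop)

/-- The value at a point, as a linear functional. -/
noncomputable def polyEvalLinear (z : EuclideanSpace ℂ (Fin d)) : MvPolynomial (Fin d) ℂ →ₗ[ℂ] ℂ :=
  (MvPolynomial.aeval fun i => z i).toLinearMap

theorem polyEvalLinear_apply (z : EuclideanSpace ℂ (Fin d)) (p : MvPolynomial (Fin d) ℂ) :
    polyEvalLinear z p = polyEval p z := by
  simp [polyEvalLinear, polyEval, MvPolynomial.aeval_eq_eval]

section Gram

variable (μ : Measure (Sphere d)) [IsFiniteMeasure μ]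

theorem memLp_of_continuous {g : Sphere d → ℂ} (hg : Continuous g) : MemLp g 2 μ := by
  obtain ⟨C, hC⟩ := isCompact_univ.exists_bound_of_continuousOn hg.continuousOn
  exact MemLp.of_bound hg.aestronglyMeasurable C (Eventually.of_forall fun x => hC x trivial)

/-- The class of a polynomial in `L²(μ)`, which turns `polyInner` into an inner product of a
Hilbert space. -/
noncomputable def polyToLp : MvPolynomial (Fin d) ℂ →ₗ[ℂ] Lp ℂ 2 μ where
  toFun p := MemLp.toLp (fun ζ : Sphere d => polyEval p ζ) (memLp_of_continuous μ (by fun_prop))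
  map_add' p q := by
    rw [← MemLp.toLp_add]
    congr 1
    ext ζ
    simp [polyEval]
  map_smul' c p := by
    rw [RingHom.id_apply, ← MemLp.toLp_const_smul]
    congr 1
    ext ζ
    simp [polyEval]

theorem inner_polyToLp (p q : MvPolynomial (Fin d) ℂ) :
    inner ℂ (polyToLp μ q) (polyToLp μ p) = polyInner μ p q := by
  rw [L2.inner_def, polyInner]
  refine integral_congr_ae ?_
  filter_upwards [MemLp.coeFn_toLp (memLp_of_continuous μ (g := fun ζ : Sphere d => polyEval p ζ)
      (by fun_prop)), MemLp.coeFn_toLp (memLp_of_continuous μ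
      (g := fun ζ : Sphere d => polyEval q ζ) (by fun_prop))] with ζ h1 h2
  rw [RCLike.inner_apply]
  exact congrArg₂ (· * (starRingEnd ℂ) ·) h1 h2

theorem norm_polyToLp_sq (p : MvPolynomial (Fin d) ℂ) :
    ‖polyToLp μ p‖ ^ 2 = ∫ ζ : Sphere d, ‖polyEval p ζ‖ ^ 2 ∂μ := by
  have h1 : ((‖polyToLp μ p‖ ^ 2 : ℝ) : ℂ) = polyInner μ p p := by
    rw [← inner_polyToLp, inner_self_eq_norm_sq_to_K]
    push_cast
    rfl
  have h2 : polyInner μ p p = ((∫ ζ : Sphere d, ‖polyEval p ζ‖ ^ 2 ∂μ : ℝ) : ℂ) := by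
    rw [polyInner, ← integral_complex_ofReal]
    refine integral_congr_ae (Eventually.of_forall fun ζ => ?_)
    simp [Complex.mul_conj, Complex.normSq_eq_norm_sq]
  exact_mod_cast h1.trans h2

open InnerProductSpace in
/-- The recursion that defines `monicOP` is that of the Gram–Schmidt process in `L²(μ)`. -/
theorem polyToLp_monicOP (α : MultiIndex d) :
    polyToLp μ (monicOP μ α) = gramSchmidt ℂ (fun β => polyToLp μ (mono β)) α := by
  induction α using WellFoundedLT.induction with
  | ind α ih =>
    rw [monicOP, gramSchmidt_def, map_sub, map_sum, ← Finset.sum_coe_sort (Finset.Iio α)]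
    congr 1
    refine Finset.sum_congr rfl fun β _ => ?_
    rw [map_smul, Submodule.starProjection_singleton, ← ih β (Finset.mem_Iio.1 β.2),
      ← inner_polyToLp, ← inner_polyToLp, inner_self_eq_norm_sq_to_K]
    push_cast
    rfl

open InnerProductSpace in
theorem polyToLp_orthonormalPoly (α : MultiIndex d) :
    polyToLp μ (orthonormalPoly μ α) = gramSchmidtNormed ℂ (fun β => polyToLp μ (mono β)) α := by
  have h : Real.sqrt (polyInner μ (monicOP μ α) (monicOP μ α)).re = ‖polyToLp μ (monicOP μ α)‖ := by
    rw [← inner_polyToLp, inner_self_eq_norm_sq_to_K, ← RCLike.ofReal_pow]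
    exact Real.sqrt_sq (norm_nonneg _)
  rw [orthonormalPoly, map_smul, h, polyToLp_monicOP, gramSchmidtNormed]
  push_cast
  rfl

variable {μ}

/-- A linear relation between the monomials in `L²(μ)` is a vector in the left kernel of a moment
matrix. -/
theorem IsNontrivial.linearIndependent (hμ : IsNontrivial μ) :
    LinearIndependent ℂ fun α : MultiIndex d => polyToLp μ (mono α) := by
  classical
  rw [linearIndependent_iff']
  intro s g hg α hα
  obtain ⟨A, hA⟩ : ∃ A, s ⊆ Finset.Iic A :=
    ⟨s.max' ⟨α, hα⟩, fun β hβ => Finset.mem_Iic.2 (s.le_max' β hβ)⟩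
  have hinj := Matrix.vecMul_injective_iff_isUnit.2 (hμ A)
  set v : Finset.Iic A → ℂ := fun β => if (β : MultiIndex d) ∈ s then g β else 0 with hv
  have hsum : ∑ β : Finset.Iic A, v β • polyToLp μ (mono (β : MultiIndex d)) = 0 := by
    rw [Finset.sum_coe_sort (Finset.Iic A)
      (fun β => (if β ∈ s then g β else 0) • polyToLp μ (mono β))]
    simp only [ite_smul, zero_smul, Finset.sum_ite_mem]
    rwa [Finset.inter_eq_right.2 hA]
  have h0 : Matrix.vecMul v (Matrix.of fun β γ : Finset.Iic A =>
      momentKernel μ (β : MultiIndex d) γ) = 0 := by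
    ext γ
    have h1 := congrArg (fun u => inner ℂ (polyToLp μ (mono (γ : MultiIndex d))) u) hsum
    simp only [inner_sum, inner_smul_right, inner_polyToLp, inner_zero_right] at h1
    simpa [Matrix.vecMul, dotProduct, momentKernel] using h1
  have hv0 : v = 0 := hinj (by simpa using h0)
  have := congrFun hv0 ⟨α, hA hα⟩
  simpa [hv, hα] using this

theorem IsNontrivial.orthonormal (hμ : IsNontrivial μ) :
    Orthonormal ℂ fun α : MultiIndex d => polyToLp μ (orthonormalPoly μ α) := by
  simp only [polyToLp_orthonormalPoly]
  exact InnerProductSpace.gramSchmidtNormed_orthonormal hμ.linearIndependent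

theorem monicOP_mem_span (hμ : IsNontrivial μ) (α : MultiIndex d) :
    monicOP μ α ∈ Submodule.span ℂ {orthonormalPoly μ α} := by
  set c : ℂ := (((Real.sqrt (polyInner μ (monicOP μ α) (monicOP μ α)).re)⁻¹ : ℝ) : ℂ) with hc
  have h1 : orthonormalPoly μ α = c • monicOP μ α := rfl
  have hc0 : c ≠ 0 := by
    intro h0
    rw [h0, zero_smul] at h1
    have h2 := hμ.orthonormal.1 α
    simp [h1] at h2
  exact Submodule.mem_span_singleton.2 ⟨c⁻¹, by rw [h1, smul_smul, inv_mul_cancel₀ hc0, one_smul]⟩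

theorem span_mono_le_span_orthonormalPoly (hμ : IsNontrivial μ) (A : MultiIndex d) :
    Submodule.span ℂ (mono '' Set.Iic A) ≤
      Submodule.span ℂ (orthonormalPoly μ '' Set.Iic A) := by
  have hmon : ∀ β ≤ A, monicOP μ β ∈ Submodule.span ℂ (orthonormalPoly μ '' Set.Iic A) :=
    fun β hβ => Submodule.span_mono
      (Set.singleton_subset_iff.2 (Set.mem_image_of_mem (orthonormalPoly μ) (Set.mem_Iic.2 hβ)))
      (monicOP_mem_span hμ β)
  refine Submodule.span_le.2 ?_
  rintro _ ⟨α, hα : α ≤ A, rfl⟩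
  have h1 : mono α = monicOP μ α + ∑ β : Finset.Iio α,
      (polyInner μ (mono α) (monicOP μ β) / polyInner μ (monicOP μ β) (monicOP μ β)) •
        monicOP μ β := by
    conv_rhs => rw [monicOP]
    rw [sub_add_cancel]
  rw [h1]
  refine Submodule.add_mem _ (hmon α hα) (Submodule.sum_mem _ fun β _ =>
    Submodule.smul_mem _ _ (hmon β ((Finset.mem_Iio.1 β.2).le.trans hα)))

theorem exists_eq_sum_orthonormalPoly (hμ : IsNontrivial μ) {A : MultiIndex d}
    {p : MvPolynomial (Fin d) ℂ} (hp : p ∈ Submodule.span ℂ (mono '' Set.Iic A)) :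
    ∃ c : MultiIndex d → ℂ, p = ∑ α ∈ Finset.Iic A, c α • orthonormalPoly μ α := by
  have h := span_mono_le_span_orthonormalPoly hμ A hp
  rw [← Finset.coe_Iic] at h
  obtain ⟨c, hc⟩ := (Submodule.mem_span_image_finset_iff_exists_fun ℂ).1 h
  refine ⟨fun α => if h : α ∈ Finset.Iic A then c ⟨α, h⟩ else 0, ?_⟩
  rw [← hc, ← Finset.sum_coe_sort (Finset.Iic A)]
  exact Finset.sum_congr rfl fun α _ => by simp only [dif_pos α.2]

theorem integral_norm_sq_sum_orthonormalPoly (hμ : IsNontrivial μ) (c : MultiIndex d → ℂ)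
    (s : Finset (MultiIndex d)) :
    ∫ ζ : Sphere d, ‖polyEval (∑ α ∈ s, c α • orthonormalPoly μ α) ζ‖ ^ 2 ∂μ
      = ∑ α ∈ s, ‖c α‖ ^ 2 := by
  rw [← norm_polyToLp_sq]
  have h1 := hμ.orthonormal.inner_sum c c s
  have h2 : polyToLp μ (∑ α ∈ s, c α • orthonormalPoly μ α)
      = ∑ α ∈ s, c α • polyToLp μ (orthonormalPoly μ α) := by simp
  rw [← h2, inner_self_eq_norm_sq_to_K] at h1
  have h3 : ((‖polyToLp μ (∑ α ∈ s, c α • orthonormalPoly μ α)‖ ^ 2 : ℝ) : ℂ)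
      = ((∑ α ∈ s, ‖c α‖ ^ 2 : ℝ) : ℂ) := by
    push_cast
    refine Eq.trans ?_ (h1.trans (Finset.sum_congr rfl fun α _ => ?_))
    · rfl
    · rw [Complex.conj_mul']
  exact_mod_cast h3

/-- The Christoffel approximate is a lower bound of `∫ |p|² dμ` over the polynomials `p` of degree
at most `n` with `p(0) = 1`. -/
theorem christoffelApprox_le (hμ : IsNontrivial μ) {n : ℕ} {p : MvPolynomial (Fin d) ℂ}
    (hp : p ∈ Submodule.span ℂ (mono '' Set.Iic (MultiIndex.last n : MultiIndex d)))
    (hp0 : polyEval p 0 = 1) :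
    christoffelApprox μ n 0 ≤ ∫ ζ : Sphere d, ‖polyEval p ζ‖ ^ 2 ∂μ := by
  obtain ⟨c, rfl⟩ := exists_eq_sum_orthonormalPoly hμ hp
  rw [integral_norm_sq_sum_orthonormalPoly hμ, christoffelApprox]
  set S := ∑ α ∈ Finset.Iic (MultiIndex.last n : MultiIndex d),
    ‖polyEval (orthonormalPoly μ α) 0‖ ^ 2 with hS
  have h1 : (1 : ℝ) ≤ (∑ α ∈ Finset.Iic (MultiIndex.last n : MultiIndex d), ‖c α‖ ^ 2) * S := by
    have h2 : ∑ α ∈ Finset.Iic (MultiIndex.last n : MultiIndex d),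
        c α * polyEval (orthonormalPoly μ α) 0 = 1 := by
      rw [← hp0, ← polyEvalLinear_apply]
      simp [polyEvalLinear_apply]
    have h3 : (1 : ℝ) ≤ ∑ α ∈ Finset.Iic (MultiIndex.last n : MultiIndex d),
        ‖c α‖ * ‖polyEval (orthonormalPoly μ α) 0‖ := by
      have := norm_sum_le (Finset.Iic (MultiIndex.last n : MultiIndex d))
        fun α => c α * polyEval (orthonormalPoly μ α) 0
      rw [h2, norm_one] at this
      simpa using this
    calc (1 : ℝ) ≤ _ := one_le_pow₀ h3 (n := 2)
      _ ≤ _ := Finset.sum_mul_sq_le_sq_mul_sq _ _ _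
  have hS0 : 0 ≤ S := Finset.sum_nonneg fun _ _ => by positivity
  rcases hS0.eq_or_lt with h | h
  · rw [← h, mul_zero] at h1
    linarith
  · rwa [inv_le_iff_one_le_mul₀ h]

theorem sum_norm_sq_orthonormalPoly_pos (hd : 1 ≤ d) (hμ : IsNontrivial μ) (n : ℕ) :
    0 < ∑ α ∈ Finset.Iic (MultiIndex.last n : MultiIndex d),
      ‖polyEval (orthonormalPoly μ α) 0‖ ^ 2 := by
  refine (Finset.sum_nonneg fun _ _ => by positivity).lt_of_ne' fun h => ?_
  have h1 := (Finset.sum_eq_zero_iff_of_nonneg fun _ _ => by positivity).1 h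
  -- otherwise every polynomial of degree at most `n` would vanish at the origin
  obtain ⟨c, hc⟩ := exists_eq_sum_orthonormalPoly hμ (A := MultiIndex.last n)
    (p := mono (⟨0⟩ : MultiIndex d))
    (Submodule.subset_span ⟨_, MultiIndex.le_last hd (by simp [MultiIndex.length]), rfl⟩)
  have h2 := congrArg (polyEvalLinear 0) hc
  rw [map_sum, Finset.sum_eq_zero] at h2
  · simp [polyEvalLinear_apply, polyEval, mono] at h2
  · intro α hα
    have := h1 α hα
    simp only [ne_eq, OfNat.ofNat_ne_zero, not_false_eq_true, pow_eq_zero_iff, norm_eq_zero]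
      at this
    simp [polyEvalLinear_apply, this]

/-- The lower bound of `christoffelApprox_le` is attained. -/
theorem exists_integral_eq_christoffelApprox (hd : 1 ≤ d) (hμ : IsNontrivial μ) (n : ℕ) :
    ∃ p : MvPolynomial (Fin d) ℂ, polyEval p 0 = 1 ∧
      ∫ ζ : Sphere d, ‖polyEval p ζ‖ ^ 2 ∂μ = christoffelApprox μ n 0 := by
  have hS0 := (sum_norm_sq_orthonormalPoly_pos hd hμ n).ne'
  rw [christoffelApprox]
  set S := ∑ α ∈ Finset.Iic (MultiIndex.last n : MultiIndex d),
    ‖polyEval (orthonormalPoly μ α) 0‖ ^ 2 with hS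
  -- the reproducing kernel at the origin, normalised to have value one there
  refine ⟨∑ α ∈ Finset.Iic (MultiIndex.last n : MultiIndex d),
    (((S⁻¹ : ℝ) : ℂ) * (starRingEnd ℂ) (polyEval (orthonormalPoly μ α) 0)) • orthonormalPoly μ α,
    ?_, ?_⟩
  · rw [← polyEvalLinear_apply, map_sum]
    simp only [map_smul, polyEvalLinear_apply, smul_eq_mul, mul_assoc, Complex.conj_mul']
    rw [← Finset.mul_sum]
    have : (S : ℂ) = ∑ α ∈ Finset.Iic (MultiIndex.last n : MultiIndex d),
        (‖polyEval (orthonormalPoly μ α) 0‖ : ℂ) ^ 2 := by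
      rw [hS]; push_cast; rfl
    rw [← this]
    exact_mod_cast inv_mul_cancel₀ hS0
  · rw [integral_norm_sq_sum_orthonormalPoly hμ]
    simp only [norm_mul, mul_pow, RCLike.norm_conj, Complex.norm_real, Real.norm_eq_abs, sq_abs]
    rw [← Finset.mul_sum, ← hS]
    field_simp

theorem antitone_christoffelApprox (hd : 1 ≤ d) (hμ : IsNontrivial μ) :
    Antitone fun n => christoffelApprox μ n 0 := by
  intro m n hmn
  refine inv_anti₀ (sum_norm_sq_orthonormalPoly_pos hd hμ m) ?_
  exact Finset.sum_le_sum_of_subset_of_nonneg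
    (Finset.Iic_subset_Iic.2 (MultiIndex.monotone_last hd hmn)) fun _ _ _ => by positivity

theorem tendsto_christoffelApprox (hd : 1 ≤ d) (hμ : IsNontrivial μ) :
    Tendsto (fun n => christoffelApprox μ n 0) atTop (𝓝 (christoffelFunction μ 0)) := by
  refine tendsto_nhds_limUnder ⟨_, tendsto_atTop_ciInf (antitone_christoffelApprox hd hμ) ⟨0, ?_⟩⟩
  rintro _ ⟨n, rfl⟩
  exact inv_nonneg.2 (Finset.sum_nonneg fun _ _ => by positivity)

theorem christoffelFunction_le (hd : 1 ≤ d) (hμ : IsNontrivial μ) {p : MvPolynomial (Fin d) ℂ}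
    (hp0 : polyEval p 0 = 1) :
    christoffelFunction μ 0 ≤ ∫ ζ : Sphere d, ‖polyEval p ζ‖ ^ 2 ∂μ :=
  ((antitone_christoffelApprox hd hμ).le_of_tendsto (tendsto_christoffelApprox hd hμ) _).trans
    (christoffelApprox_le hμ (mem_span_mono_of_totalDegree_le hd p) hp0)

end Gram

theorem ofReal_integral_norm_sq {μ : Measure (Sphere d)} [IsFiniteMeasure μ] {g : Sphere d → ℂ}
    (hg : Continuous g) :
    ENNReal.ofReal (∫ ζ, ‖g ζ‖ ^ 2 ∂μ) = ∫⁻ ζ, ‖g ζ‖ₑ ^ 2 ∂μ := by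
  rw [ofReal_integral_eq_lintegral_ofReal]
  · simp only [ENNReal.ofReal_pow (norm_nonneg _), ofReal_norm]
  · exact (memLp_of_continuous μ hg).integrable_norm_pow two_ne_zero
  · exact Eventually.of_forall fun ζ => by positivity

/-! ### Circular slices of the sphere -/

theorem isProbabilityMeasure_sigma (hd : 1 ≤ d) : IsProbabilityMeasure (sigma d) := by
  have : Nonempty (Fin d) := ⟨⟨0, hd⟩⟩
  refine ⟨?_⟩
  rw [sigma, Measure.smul_apply, smul_eq_mul]
  exact ENNReal.inv_mul_cancel (Measure.measure_univ_ne_zero.2 (Measure.toSphere_ne_zero _))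
    (measure_ne_top _ _)

/-- The rotation of the sphere by the unimodular factor `e^{it}`. -/
noncomputable def rotate (t : ℝ) (ζ : Sphere d) : Sphere d :=
  ⟨circleMap 0 1 t • (ζ : EuclideanSpace ℂ (Fin d)), by
    rw [mem_sphere_zero_iff_norm, norm_smul]
    simp⟩

theorem coe_rotate (t : ℝ) (ζ : Sphere d) :
    (rotate t ζ : EuclideanSpace ℂ (Fin d)) = circleMap 0 1 t • (ζ : EuclideanSpace ℂ (Fin d)) :=
  rfl

theorem continuous_rotate : Continuous fun x : Sphere d × ℝ => rotate x.2 x.1 := by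
  refine Continuous.subtype_mk ?_ _
  fun_prop

/-- Multiplication by `e^{it}` as an isometry of `ℂᵈ`. -/
noncomputable def circleIsometry (d : ℕ) (t : ℝ) :
    EuclideanSpace ℂ (Fin d) ≃ₗᵢ[ℝ] EuclideanSpace ℂ (Fin d) :=
  LinearIsometryEquiv.mk
    ((LinearEquiv.smulOfNeZero ℂ (EuclideanSpace ℂ (Fin d)) (circleMap 0 1 t)
      (circleMap_ne_center one_ne_zero)).restrictScalars ℝ) (fun x => by
    change ‖circleMap 0 1 t • x‖ = ‖x‖
    rw [norm_smul]
    simp)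

open scoped Pointwise in
theorem measurePreserving_rotate (t : ℝ) :
    MeasurePreserving (rotate t) (sigma d) (sigma d) := by
  have hc : Continuous (rotate t : Sphere d → Sphere d) :=
    Continuous.subtype_mk (continuous_subtype_val.const_smul (circleMap 0 1 t)) _
  refine MeasurePreserving.smul_measure ⟨hc.measurable, ?_⟩ _
  ext s hs
  rw [Measure.map_apply hc.measurable hs, Measure.toSphere_apply' _ (hc.measurable hs),
    Measure.toSphere_apply' _ hs]
  congr 1
  have hpres : MeasurePreserving (circleIsometry d t) volume volume :=
    (circleIsometry d t).measurePreserving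
  refine (congrArg _ ?_).trans
    (hpres.measure_preimage_emb (circleIsometry d t).toHomeomorph.measurableEmbedding _)
  ext x
  simp only [Set.mem_preimage, Set.mem_smul, Set.mem_image]
  constructor
  · rintro ⟨a, ha, _, ⟨ζ, hζ, rfl⟩, rfl⟩
    exact ⟨a, ha, _, ⟨rotate t ζ, hζ, rfl⟩, ((circleIsometry d t).map_smul a _).symm⟩
  · rintro ⟨a, ha, _, ⟨ζ, hζ, rfl⟩, hx⟩
    have hmem : (circleIsometry d t).symm ζ ∈ Metric.sphere (0 : EuclideanSpace ℂ (Fin d)) 1 := by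
      simp
    refine ⟨a, ha, _, ⟨⟨_, hmem⟩, ?_, rfl⟩, ?_⟩
    · have : rotate t ⟨_, hmem⟩ = ζ := Subtype.ext ((circleIsometry d t).apply_symm_apply _)
      rwa [this]
    · apply (circleIsometry d t).injective
      rw [(circleIsometry d t).map_smul, LinearIsometryEquiv.apply_symm_apply]
      exact hx

/-- A measurable property that holds almost everywhere on every circle `{e^{it} ζ}` holds almost
everywhere on the sphere. -/
theorem ae_sigma_of_forall_ae_rotate [IsFiniteMeasure (sigma d)] {P : Sphere d → Prop}
    (hP : MeasurableSet {ζ | P ζ}) (h : ∀ ζ, ∀ᵐ t : ℝ, P (rotate t ζ)) :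
    ∀ᵐ ζ ∂(sigma d), P ζ := by
  have h1 : ∀ᵐ t : ℝ, ∀ᵐ ζ ∂(sigma d), P (rotate t ζ) := by
    refine (Measure.ae_ae_comm ?_).1 (Eventually.of_forall h)
    exact continuous_rotate.measurable hP
  obtain ⟨t, ht⟩ := h1.exists
  have h2 := (measurePreserving_rotate (d := d) t).map_eq
  rw [← h2]
  exact (ae_map_iff (measurePreserving_rotate t).measurable.aemeasurable hP).2 ht

/-- A continuous function with nonnegative means over the circles `{e^{it} ζ}` has a nonnegative
integral over the sphere. -/
theorem integral_sigma_nonneg [IsFiniteMeasure (sigma d)] {h : Sphere d → ℝ} (hc : Continuous h)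
    (hpos : ∀ ζ, 0 ≤ ∫ t in 0..2 * Real.pi, h (rotate t ζ)) : 0 ≤ ∫ ζ, h ζ ∂(sigma d) := by
  obtain ⟨C, hC⟩ := isCompact_univ.exists_bound_of_continuousOn hc.continuousOn
  have hint : Integrable (fun x : Sphere d × ℝ => h (rotate x.2 x.1))
      ((sigma d).prod (volume.restrict (Set.Ioc 0 (2 * Real.pi)))) := by
    refine Integrable.of_bound (C := C) ?_ (Eventually.of_forall fun x => hC _ trivial)
    exact (hc.comp continuous_rotate).aestronglyMeasurable
  have h1 := integral_integral_swap (f := fun ζ t => h (rotate t ζ)) hint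
  have h2 : ∀ t, ∫ ζ, h (rotate t ζ) ∂(sigma d) = ∫ ζ, h ζ ∂(sigma d) := fun t => by
    conv_rhs => rw [← (measurePreserving_rotate (d := d) t).map_eq]
    rw [integral_map (measurePreserving_rotate t).measurable.aemeasurable hc.aestronglyMeasurable]
  simp only [h2, integral_const, smul_eq_mul] at h1
  have h3 : 0 ≤ ∫ ζ, (∫ t in Set.Ioc 0 (2 * Real.pi), h (rotate t ζ)) ∂(sigma d) := by
    refine integral_nonneg fun ζ => ?_
    rw [← intervalIntegral.integral_of_le (by positivity)]
    exact hpos ζ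
  rw [h1] at h3
  have h4 : 0 < (volume.restrict (Set.Ioc 0 (2 * Real.pi))).real Set.univ := by
    simp [Real.pi_pos]
  exact nonneg_of_mul_nonneg_right h3 h4

/-- The slice `l ↦ p(l ζ)` of a polynomial, as a polynomial in one variable. -/
noncomputable def slicePoly (p : MvPolynomial (Fin d) ℂ) (ζ : EuclideanSpace ℂ (Fin d)) :
    Polynomial ℂ :=
  MvPolynomial.aeval (fun i => Polynomial.C (ζ i) * Polynomial.X) p

theorem eval_slicePoly (p : MvPolynomial (Fin d) ℂ) (ζ : EuclideanSpace ℂ (Fin d)) (l : ℂ) :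
    (slicePoly p ζ).eval l = polyEval p (l • ζ) := by
  rw [slicePoly, polyEval, ← Polynomial.coe_evalRingHom, MvPolynomial.map_aeval]
  have h : (Polynomial.evalRingHom l).comp (algebraMap ℂ (Polynomial ℂ)) = RingHom.id ℂ := by
    ext1 x
    simp
  rw [h, MvPolynomial.eval]
  simp only [Polynomial.coe_evalRingHom, Polynomial.eval_mul, Polynomial.eval_C, Polynomial.eval_X,
    PiLp.smul_apply, smul_eq_mul, mul_comm]

open Real in
/-- Jensen's inequality for polynomials in one variable, with the logarithm regularised. -/
theorem integral_log_norm_sq_add_nonneg {q : Polynomial ℂ} (hq : q.eval 0 = 1) {ε : ℝ} (hε : 0 < ε) :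
    0 ≤ ∫ t in 0..2 * π, log (‖q.eval (circleMap 0 1 t)‖ ^ 2 + ε) := by
  have hq0 : q ≠ 0 := by rintro rfl; simp at hq
  have h1 : 1 ≤ q.mahlerMeasure := by
    have := q.norm_coeff_le_choose_mul_mahlerMeasure 0
    rw [Polynomial.coeff_zero_eq_eval_zero, hq] at this
    simpa using this
  have h2 : 0 ≤ q.logMahlerMeasure := by
    rw [Polynomial.logMahlerMeasure_eq_log_MahlerMeasure]
    exact log_nonneg h1
  rw [Polynomial.logMahlerMeasure_def, circleAverage_def, smul_eq_mul] at h2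
  have h3 : 0 ≤ ∫ t in 0..2 * π, log ‖q.eval (circleMap 0 1 t)‖ :=
    nonneg_of_mul_nonneg_right h2 (by positivity)
  have hint : IntervalIntegrable (fun t => 2 * log ‖q.eval (circleMap 0 1 t)‖) volume 0 (2 * π) := by
    refine IntervalIntegrable.const_mul ?_ 2
    exact MeromorphicOn.circleIntegrable_log_norm (f := fun z => q.eval z) (c := 0) (R := 1)
      fun z _ => (q.differentiable.analyticAt z).meromorphicAt
  have hint2 : IntervalIntegrable (fun t => log (‖q.eval (circleMap 0 1 t)‖ ^ 2 + ε)) volume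
      0 (2 * π) := by
    refine Continuous.intervalIntegrable (Continuous.log (by fun_prop) fun t => ?_) _ _
    positivity
  calc (0 : ℝ) ≤ 2 * ∫ t in 0..2 * π, log ‖q.eval (circleMap 0 1 t)‖ := by linarith
    _ = ∫ t in 0..2 * π, 2 * log ‖q.eval (circleMap 0 1 t)‖ := by
      rw [intervalIntegral.integral_const_mul]
    _ ≤ _ := by
      refine intervalIntegral.integral_mono_ae (by positivity) hint hint2 ?_
      have hcount : (circleMap 0 1 ⁻¹' (q.rootSet ℂ)).Countable :=
        (q.rootSet_finite ℂ).countable.preimage_circleMap 0 one_ne_zero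
      filter_upwards [hcount.ae_notMem volume] with t ht
      have hne : q.eval (circleMap 0 1 t) ≠ 0 := by
        simpa [Polynomial.mem_rootSet, hq0] using ht
      have hpos : 0 < ‖q.eval (circleMap 0 1 t)‖ := norm_pos_iff.2 hne
      have : 2 * log ‖q.eval (circleMap 0 1 t)‖ = log (‖q.eval (circleMap 0 1 t)‖ ^ 2) := by
        rw [log_pow]; norm_num
      rw [this]
      exact log_le_log (by positivity) (by linarith)

/-- The subharmonic mean value inequality at the centre of the ball. -/
theorem integral_sigma_log_nonneg [IsFiniteMeasure (sigma d)] {p : MvPolynomial (Fin d) ℂ}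
    (hp : polyEval p 0 = 1) {ε : ℝ} (hε : 0 < ε) :
    0 ≤ ∫ ζ : Sphere d, Real.log (‖polyEval p ζ‖ ^ 2 + ε) ∂(sigma d) := by
  refine integral_sigma_nonneg (Continuous.log (by fun_prop) fun ζ => by positivity) fun ζ => ?_
  simp only [coe_rotate, ← eval_slicePoly]
  exact integral_log_norm_sq_add_nonneg (by rw [eval_slicePoly, zero_smul, hp]) hε

/-- For a function on the reals that is continuous on `(0, 1)`, the existence of a left limit at `1`
is decided by its values at the rationals. -/
theorem exists_tendsto_iff_rat {g : ℝ → ℂ} (hg : ContinuousOn g (Set.Ioo 0 1)) :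
    (∃ c, Tendsto g (𝓝[<] 1) (𝓝 c)) ↔
      ∃ c, Tendsto (fun q : ℚ => g q) (comap ((↑) : ℚ → ℝ) (𝓝[<] 1)) (𝓝 c) := by
  refine exists_congr fun c => ⟨fun h => h.comp tendsto_comap, fun h => ?_⟩
  rw [Metric.nhds_basis_closedBall.tendsto_right_iff] at h ⊢
  intro ε hε
  obtain ⟨s, hs, hsub⟩ := mem_comap.1 (h ε hε)
  obtain ⟨a, ha, has⟩ := (mem_nhdsLT_iff_exists_Ioo_subset' (show (0 : ℝ) < 1 by norm_num)).1 hs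
  filter_upwards [Ioo_mem_nhdsLT (show max a 0 < 1 from max_lt ha one_pos)] with x hx
  by_contra hne
  have hsub2 : Set.Ioo (max a 0) 1 ⊆ Set.Ioo 0 1 := Set.Ioo_subset_Ioo_left (le_max_right _ _)
  have hopen : IsOpen (Set.Ioo (max a 0) 1 ∩ g ⁻¹' (Metric.closedBall c ε)ᶜ) :=
    (hg.mono hsub2).isOpen_inter_preimage isOpen_Ioo Metric.isClosed_closedBall.isOpen_compl
  obtain ⟨q, hq⟩ := Rat.denseRange_cast.exists_mem_open hopen ⟨x, hx, hne⟩
  exact hq.2 (hsub (show (q : ℝ) ∈ s from has ⟨(le_max_left _ _).trans_lt hq.1.1, hq.1.2⟩))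

theorem smul_sphere_mem_ball {r : ℝ} (hr : r ∈ Set.Ioo (0 : ℝ) 1) (ζ : Sphere d) :
    r • (ζ : EuclideanSpace ℂ (Fin d)) ∈ Metric.ball 0 1 := by
  rw [mem_ball_zero_iff, norm_smul, mem_sphere_zero_iff_norm.1 ζ.2, mul_one, Real.norm_eq_abs,
    abs_of_pos hr.1]
  exact hr.2

/-- Fatou's theorem on the ball: it follows from the theorem on the disc, applied to the slices. -/
theorem ae_sigma_exists_tendsto_radial [IsFiniteMeasure (sigma d)]
    {f : EuclideanSpace ℂ (Fin d) → ℂ} (hf : IsHInfty f) :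
    ∀ᵐ ζ : Sphere d ∂(sigma d), ∃ c,
      Tendsto (fun r : ℝ => f (r • (ζ : EuclideanSpace ℂ (Fin d)))) (𝓝[<] 1) (𝓝 c) := by
  obtain ⟨hd, C, hC⟩ := hf
  refine ae_sigma_of_forall_ae_rotate ?_ fun ζ => ?_
  · have hcont : ∀ ζ : Sphere d,
        ContinuousOn (fun r : ℝ => f (r • (ζ : EuclideanSpace ℂ (Fin d)))) (Set.Ioo 0 1) := fun ζ =>
      hd.continuousOn.comp (by fun_prop) fun r hr => smul_sphere_mem_ball hr ζ
    -- the set of convergence is measurable, as it is decided by countably many radii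
    have hset : {ζ : Sphere d | ∃ c, Tendsto (fun r : ℝ => f (r • (ζ : EuclideanSpace ℂ (Fin d))))
          (𝓝[<] 1) (𝓝 c)} =
        {ζ : Sphere d | ∃ c, Tendsto (fun q : ℚ => if (q : ℝ) ∈ Set.Ioo (0 : ℝ) 1 then
            f ((q : ℝ) • (ζ : EuclideanSpace ℂ (Fin d))) else 0)
          (comap ((↑) : ℚ → ℝ) (𝓝[<] 1)) (𝓝 c)} := by
      ext ζ
      simp only [Set.mem_ofPred_eq]
      rw [exists_tendsto_iff_rat (hcont ζ)]
      refine exists_congr fun c => tendsto_congr' ?_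
      filter_upwards [preimage_mem_comap (Ioo_mem_nhdsLT (show (0 : ℝ) < 1 by norm_num))] with q hq
      exact (if_pos (show (q : ℝ) ∈ Set.Ioo (0 : ℝ) 1 from hq)).symm
    rw [hset]
    refine measurableSet_exists_tendsto fun q => ?_
    split_ifs with hq
    · refine Continuous.measurable ?_
      exact hd.continuousOn.comp_continuous (by fun_prop) fun ζ => smul_sphere_mem_ball hq ζ
    · exact measurable_const
  · have hζ : ‖(ζ : EuclideanSpace ℂ (Fin d))‖ = 1 := mem_sphere_zero_iff_norm.1 ζ.2
    have hmem : ∀ l ∈ Metric.ball (0 : ℂ) 1,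
        l • (ζ : EuclideanSpace ℂ (Fin d)) ∈ Metric.ball 0 1 := by
      intro l hl
      rw [mem_ball_zero_iff] at hl ⊢
      rwa [norm_smul, hζ, mul_one]
    have h := ae_exists_tendsto_radial (g := fun l => f (l • (ζ : EuclideanSpace ℂ (Fin d))))
      (hd.comp (by fun_prop) hmem) (fun l hl => hC _ (hmem l hl))
    filter_upwards [h] with t ⟨c, hc⟩
    refine ⟨c, hc.congr fun r => ?_⟩
    rw [coe_rotate, mul_smul, Complex.coe_smul]

/-- A radial limit determines the boundary value: it agrees with the K-limit if that exists, since
the radius lies in every Korányi region, and the boundary value is the radial limit otherwise. -/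
theorem boundaryValue_eq_of_tendsto {f : EuclideanSpace ℂ (Fin d) → ℂ} {ζ : Sphere d} {c : ℂ}
    (h : Tendsto (fun r : ℝ => f (r • (ζ : EuclideanSpace ℂ (Fin d)))) (𝓝[<] 1) (𝓝 c)) :
    boundaryValue f ζ = c := by
  rw [boundaryValue]
  split_ifs with hK
  · have h1 := hK.choose_spec 2 one_lt_two
    refine tendsto_nhds_unique (h1.comp (f := fun r : ℝ => r • (ζ : EuclideanSpace ℂ (Fin d))) ?_) h
    have hζ : ‖(ζ : EuclideanSpace ℂ (Fin d))‖ = 1 := mem_sphere_zero_iff_norm.1 ζ.2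
    refine tendsto_nhdsWithin_iff.2 ⟨?_, ?_⟩
    · have : Tendsto (fun r : ℝ => r • (ζ : EuclideanSpace ℂ (Fin d))) (𝓝 1)
          (𝓝 ((1 : ℝ) • (ζ : EuclideanSpace ℂ (Fin d)))) := Continuous.tendsto (by fun_prop) _
      rw [one_smul] at this
      exact this.mono_left nhdsWithin_le_nhds
    · -- the radius lies in the Korányi region: `1 - r < 1 - r²`
      filter_upwards [Ioo_mem_nhdsLT (show (0 : ℝ) < 1 by norm_num)] with r hr
      have h2 : ‖(r • (ζ : EuclideanSpace ℂ (Fin d)))‖ = r := by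
        rw [norm_smul, hζ, mul_one, Real.norm_eq_abs, abs_of_pos hr.1]
      refine ⟨by rw [mem_ball_zero_iff, h2]; exact hr.2, ?_⟩
      have h3 : (inner ℂ (ζ : EuclideanSpace ℂ (Fin d)) (r • (ζ : EuclideanSpace ℂ (Fin d))) : ℂ)
          = (r : ℂ) := by
        rw [← Complex.coe_smul, inner_smul_right, inner_self_eq_norm_sq_to_K, hζ]
        simp
      have h4 : (1 : ℂ) - r = ((1 - r : ℝ) : ℂ) := by push_cast; rfl
      rw [h2, h3, h4, Complex.norm_real, Real.norm_eq_abs, abs_of_pos (by linarith [hr.2])]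
      nlinarith [hr.1, hr.2]
  · exact h.limUnder_eq

/-! ### The lower bound -/

/-- Either the entropy vanishes, or `log w` is integrable and the entropy is the exponential of its
Bochner integral. The positive part of `log w` is always integrable, being at most `w`. -/
theorem szegoEntropy_eq_zero_or [IsFiniteMeasure (sigma d)] {w : Sphere d → ℝ}
    (hw : Integrable w (sigma d)) :
    szegoEntropy w = 0 ∨ ((∀ᵐ ζ ∂(sigma d), 0 < w ζ) ∧
      Integrable (fun ζ => Real.log (w ζ)) (sigma d) ∧
      szegoEntropy w = ENNReal.ofReal (Real.exp (∫ ζ, Real.log (w ζ) ∂(sigma d)))) := by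
  set g : Sphere d → EReal := fun ζ => ENNReal.log (ENNReal.ofReal (w ζ)) with hg
  have hgm : AEMeasurable g (sigma d) :=
    ENNReal.measurable_log.comp_aemeasurable hw.aemeasurable.ennreal_ofReal
  have hcoe : ∀ x : ℝ, (x : EReal).toENNReal = ENNReal.ofReal x := fun x => by
    simp [EReal.toENNReal]
  by_cases hN : ∫⁻ ζ, (-g ζ).toENNReal ∂(sigma d) = ⊤
  · left
    rw [szegoEntropy, eintegral, hN]
    simp
  · right
    have hpos : ∀ᵐ ζ ∂(sigma d), 0 < w ζ := by
      filter_upwards [ae_lt_top' (measurable_ereal_toENNReal.comp_aemeasurable hgm.neg) hN]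
        with ζ hζ
      by_contra hle
      have h0 : g ζ = ⊥ := by
        simp only [hg, ENNReal.ofReal_of_nonpos (not_lt.1 hle), ENNReal.log_zero]
      simp [h0] at hζ
    have hlog : ∀ {ζ}, 0 < w ζ → g ζ = (Real.log (w ζ) : EReal) := fun h =>
      ENNReal.log_ofReal_of_pos h
    have hlm : AEStronglyMeasurable (fun ζ => Real.log (w ζ)) (sigma d) :=
      (Real.measurable_log.comp_aemeasurable hw.aemeasurable).aestronglyMeasurable
    have hP : ∫⁻ ζ, (g ζ).toENNReal ∂(sigma d)
        = ∫⁻ ζ, ENNReal.ofReal (Real.log (w ζ)) ∂(sigma d) :=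
      lintegral_congr_ae (hpos.mono fun ζ h => by simp only [hlog h, hcoe])
    have hN2 : ∫⁻ ζ, (-g ζ).toENNReal ∂(sigma d)
        = ∫⁻ ζ, ENNReal.ofReal (-Real.log (w ζ)) ∂(sigma d) :=
      lintegral_congr_ae (hpos.mono fun ζ h => by
        simp only [hlog h, ← EReal.coe_neg, hcoe])
    have hPfin : ∫⁻ ζ, ENNReal.ofReal (Real.log (w ζ)) ∂(sigma d) ≠ ⊤ := by
      refine ne_top_of_le_ne_top hw.lintegral_lt_top.ne (lintegral_mono_ae ?_)
      filter_upwards [hpos] with ζ h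
      exact ENNReal.ofReal_le_ofReal (Real.log_le_self h.le)
    have hint : Integrable (fun ζ => Real.log (w ζ)) (sigma d) := by
      refine ⟨hlm, ?_⟩
      rw [HasFiniteIntegral]
      calc ∫⁻ ζ, ‖Real.log (w ζ)‖ₑ ∂(sigma d)
          ≤ ∫⁻ ζ, (ENNReal.ofReal (Real.log (w ζ)) + ENNReal.ofReal (-Real.log (w ζ))) ∂(sigma d) := by
            refine lintegral_mono fun ζ => ?_
            rw [Real.enorm_eq_ofReal_abs]
            rcases abs_cases (Real.log (w ζ)) with h | h
            · rw [h.1]; exact le_self_add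
            · rw [h.1]; exact le_add_self
        _ = _ := lintegral_add_left' hlm.aemeasurable.ennreal_ofReal _
        _ < ⊤ := ENNReal.add_lt_top.2 ⟨hPfin.lt_top, by rw [← hN2]; exact Ne.lt_top hN⟩
    refine ⟨hpos, hint, ?_⟩
    have he : eintegral (sigma d) g = ((∫ ζ, Real.log (w ζ) ∂(sigma d) : ℝ) : EReal) := by
      rw [eintegral, hP, hN2, integral_eq_lintegral_pos_part_sub_lintegral_neg_part hint,
        EReal.coe_sub, EReal.coe_ennreal_toReal hPfin,
        EReal.coe_ennreal_toReal (by rw [← hN2]; exact hN)]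
    rw [szegoEntropy, he, EReal.exp_coe]

/-- The lower bound: Jensen's inequality for the exponential, combined with the mean value
inequality for `log |p|²`. -/
theorem szegoEntropy_le_lintegral [IsProbabilityMeasure (sigma d)] {w : Sphere d → ℝ}
    (hw : Integrable w (sigma d)) (hw0 : ∀ᵐ ζ ∂(sigma d), 0 ≤ w ζ) {p : MvPolynomial (Fin d) ℂ}
    (hp : polyEval p 0 = 1) :
    szegoEntropy w ≤
      ∫⁻ ζ : Sphere d, ‖polyEval p ζ‖ₑ ^ 2 * ENNReal.ofReal (w ζ) ∂(sigma d) := by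
  rcases szegoEntropy_eq_zero_or hw with h0 | ⟨hpos, hlog, hE⟩
  · simp [h0]
  have hcont : Continuous fun ζ : Sphere d => ‖polyEval p ζ‖ ^ 2 := by fun_prop
  obtain ⟨C, hC⟩ := isCompact_univ.exists_bound_of_continuousOn hcont.continuousOn
  have hint : Integrable (fun ζ : Sphere d => ‖polyEval p ζ‖ ^ 2 * w ζ) (sigma d) :=
    hw.bdd_mul hcont.aestronglyMeasurable (Eventually.of_forall fun ζ => hC ζ trivial)
  have hreal : Real.exp (∫ ζ, Real.log (w ζ) ∂(sigma d))
      ≤ ∫ ζ : Sphere d, ‖polyEval p ζ‖ ^ 2 * w ζ ∂(sigma d) := by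
    set m := ∫ ζ, Real.log (w ζ) ∂(sigma d) with hm
    set W := ∫ ζ, w ζ ∂(sigma d) with hW
    have hW0 : 0 ≤ W := integral_nonneg_of_ae hw0
    refine le_of_forall_pos_le_add fun δ hδ => ?_
    set ε := δ / (W + 1) with hε
    have hε0 : 0 < ε := by positivity
    have hεW : ε * W ≤ δ := by
      rw [hε, div_mul_eq_mul_div, div_le_iff₀ (by positivity)]
      nlinarith
    have hlc : Continuous fun ζ : Sphere d => Real.log (‖polyEval p ζ‖ ^ 2 + ε) :=
      Continuous.log (by fun_prop) fun ζ => by positivity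
    have hli : Integrable (fun ζ : Sphere d => Real.log (‖polyEval p ζ‖ ^ 2 + ε)) (sigma d) := by
      obtain ⟨C', hC'⟩ := isCompact_univ.exists_bound_of_continuousOn hlc.continuousOn
      exact Integrable.of_bound hlc.aestronglyMeasurable C'
        (Eventually.of_forall fun ζ => hC' ζ trivial)
    have hi1 : Integrable (fun ζ : Sphere d => Real.exp m *
        (1 + Real.log (‖polyEval p ζ‖ ^ 2 + ε) + Real.log (w ζ) - m)) (sigma d) :=
      ((((integrable_const _).add hli).add hlog).sub (integrable_const _)).const_mul _
    have hi2 : Integrable (fun ζ : Sphere d => ‖polyEval p ζ‖ ^ 2 * w ζ + ε * w ζ) (sigma d) :=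
      hint.add (hw.const_mul ε)
    calc Real.exp m ≤ Real.exp m *
          (1 + (∫ ζ : Sphere d, Real.log (‖polyEval p ζ‖ ^ 2 + ε) ∂(sigma d)) + m - m) := by
          have := integral_sigma_log_nonneg hp hε0
          have := Real.exp_pos m
          nlinarith
      _ = ∫ ζ : Sphere d, Real.exp m *
            (1 + Real.log (‖polyEval p ζ‖ ^ 2 + ε) + Real.log (w ζ) - m) ∂(sigma d) := by
          have hj : Integrable (fun ζ : Sphere d => 1 + Real.log (‖polyEval p ζ‖ ^ 2 + ε))
              (sigma d) := (integrable_const _).add hli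
          have hj2 : Integrable (fun ζ : Sphere d => 1 + Real.log (‖polyEval p ζ‖ ^ 2 + ε) +
              Real.log (w ζ)) (sigma d) := hj.add hlog
          rw [integral_const_mul, integral_sub hj2 (integrable_const _),
            integral_add hj hlog, integral_add (integrable_const _) hli]
          simp [hm]
      _ ≤ ∫ ζ : Sphere d, (‖polyEval p ζ‖ ^ 2 * w ζ + ε * w ζ) ∂(sigma d) := by
          refine integral_mono_ae hi1 hi2 ?_
          filter_upwards [hpos] with ζ hζ
          -- the tangent of the exponential at `m`
          have h1 : 0 < ‖polyEval p ζ‖ ^ 2 + ε := by positivity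
          have h2 := Real.add_one_le_exp (Real.log (‖polyEval p ζ‖ ^ 2 + ε) + Real.log (w ζ) - m)
          rw [Real.exp_sub, Real.exp_add, Real.exp_log h1, Real.exp_log hζ,
            le_div_iff₀ (Real.exp_pos m)] at h2
          linarith
      _ = (∫ ζ : Sphere d, ‖polyEval p ζ‖ ^ 2 * w ζ ∂(sigma d)) + ε * W := by
          rw [integral_add hint (hw.const_mul ε), integral_const_mul]
      _ ≤ _ := by gcongr
  rw [hE]
  refine (ENNReal.ofReal_le_ofReal hreal).trans_eq ?_
  rw [ofReal_integral_eq_lintegral_ofReal hint (hw0.mono fun ζ h => by positivity)]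
  refine lintegral_congr_ae (hw0.mono fun ζ h => ?_)
  simp only
  rw [ENNReal.ofReal_mul (by positivity), ENNReal.ofReal_pow (norm_nonneg _), ofReal_norm]

/-! ### The upper bound -/

theorem continuous_dilation {f : EuclideanSpace ℂ (Fin d) → ℂ}
    (hf : DifferentiableOn ℂ f (Metric.ball 0 1)) {r : ℝ} (hr : r ∈ Set.Ioo (0 : ℝ) 1) :
    Continuous fun ζ : Sphere d => f (r • (ζ : EuclideanSpace ℂ (Fin d))) :=
  hf.continuousOn.comp_continuous (by fun_prop) fun ζ => smul_sphere_mem_ball hr ζ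

/-- The dilations of bounded holomorphic functions may be used as test functions in the extremal
problem for the Christoffel function. -/
theorem ofReal_christoffelFunction_le (hd : 1 ≤ d) {μ : Measure (Sphere d)}
    [IsProbabilityMeasure μ] (hμ : IsNontrivial μ) {f : EuclideanSpace ℂ (Fin d) → ℂ}
    (hf : DifferentiableOn ℂ f (Metric.ball 0 1)) {C : ℝ} (hC : ∀ z ∈ Metric.ball 0 1, ‖f z‖ ≤ C)
    (hf0 : f 0 = 1) {r : ℝ} (hr : r ∈ Set.Ioo (0 : ℝ) 1) :
    ENNReal.ofReal (christoffelFunction μ 0) ≤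
      ∫⁻ ζ : Sphere d, ‖f (r • (ζ : EuclideanSpace ℂ (Fin d)))‖ₑ ^ 2 ∂μ := by
  have hc := continuous_dilation hf hr
  rw [← ofReal_integral_norm_sq hc]
  refine ENNReal.ofReal_le_ofReal ?_
  have hint : Integrable (fun ζ : Sphere d => ‖f (r • (ζ : EuclideanSpace ℂ (Fin d)))‖ ^ 2) μ :=
    (memLp_of_continuous μ hc).integrable_norm_pow two_ne_zero
  have hC0 : 0 ≤ C := (norm_nonneg _).trans (hC 0 (Metric.mem_ball_self one_pos))
  have hmain : ∀ ε : ℝ, 0 < ε → christoffelFunction μ 0 ≤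
      (∫ ζ : Sphere d, ‖f (r • (ζ : EuclideanSpace ℂ (Fin d)))‖ ^ 2 ∂μ) + (2 * C * ε + ε ^ 2) := by
    intro ε hε
    obtain ⟨p, hp0, hp⟩ := exists_polynomial_approx hf hC hr.1 hr.2 hε
    refine (christoffelFunction_le hd hμ (hp0.trans hf0)).trans ?_
    calc ∫ ζ : Sphere d, ‖polyEval p ζ‖ ^ 2 ∂μ
        ≤ ∫ ζ : Sphere d, (‖f (r • (ζ : EuclideanSpace ℂ (Fin d)))‖ ^ 2 + (2 * C * ε + ε ^ 2)) ∂μ := by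
          refine integral_mono ((memLp_of_continuous μ (by fun_prop)).integrable_norm_pow two_ne_zero)
            (hint.add (integrable_const _)) fun ζ => ?_
          have h1 := hp ζ (mem_sphere_zero_iff_norm.1 ζ.2).le
          have h2 := hC _ (smul_sphere_mem_ball hr ζ)
          have h3 : ‖polyEval p ζ‖ ≤ ‖f (r • (ζ : EuclideanSpace ℂ (Fin d)))‖ + ε := by
            linarith [norm_sub_norm_le (polyEval p ζ) (f (r • (ζ : EuclideanSpace ℂ (Fin d))))]
          have h4 := norm_nonneg (f (r • (ζ : EuclideanSpace ℂ (Fin d))))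
          have h5 := norm_nonneg (polyEval p ζ)
          simp only
          nlinarith
      _ = _ := by
          rw [integral_add hint (integrable_const _)]
          simp
  have hlim : Tendsto (fun ε : ℝ =>
      (∫ ζ : Sphere d, ‖f (r • (ζ : EuclideanSpace ℂ (Fin d)))‖ ^ 2 ∂μ) + (2 * C * ε + ε ^ 2))
      (𝓝[>] 0) (𝓝 (∫ ζ : Sphere d, ‖f (r • (ζ : EuclideanSpace ℂ (Fin d)))‖ ^ 2 ∂μ)) := by
    have : Tendsto (fun ε : ℝ =>
      (∫ ζ : Sphere d, ‖f (r • (ζ : EuclideanSpace ℂ (Fin d)))‖ ^ 2 ∂μ) + (2 * C * ε + ε ^ 2))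
      (𝓝 0) (𝓝 ((∫ ζ : Sphere d, ‖f (r • (ζ : EuclideanSpace ℂ (Fin d)))‖ ^ 2 ∂μ)
        + (2 * C * 0 + 0 ^ 2))) := Continuous.tendsto (by fun_prop) _
    simpa using this.mono_left nhdsWithin_le_nhds
  exact ge_of_tendsto hlim (by filter_upwards [self_mem_nhdsWithin] with ε hε using hmain ε hε)

/-- The rational function `∏ (1 - ⟨z, τ⟩) / (1 - s ⟨z, τ⟩)`, which vanishes at the given points of the
sphere and is almost bounded by one on the ball for `s` close to one. -/
noncomputable def zeroFactor (T : Finset (Sphere d)) (s : ℝ) (z : EuclideanSpace ℂ (Fin d)) : ℂ :=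
  ∏ τ ∈ T, (1 - inner ℂ (τ : EuclideanSpace ℂ (Fin d)) z) /
    (1 - s * inner ℂ (τ : EuclideanSpace ℂ (Fin d)) z)

/-- The Möbius function `(1 - u) / (1 - s u)` is largest on the closed disc at `u = -1`. -/
theorem norm_one_sub_div_le {s : ℝ} (hs : s ∈ Set.Ioo (0 : ℝ) 1) {u : ℂ} (hu : ‖u‖ ≤ 1) :
    1 - s * u ≠ 0 ∧ ‖(1 - u) / (1 - s * u)‖ ≤ 2 / (1 + s) := by
  have hne : 1 - s * u ≠ 0 := by
    intro h
    have h1 : (s : ℂ) * u = 1 := (sub_eq_zero.1 h).symm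
    have h2 := congrArg norm h1
    rw [norm_mul, Complex.norm_real, Real.norm_eq_abs, abs_of_pos hs.1, norm_one] at h2
    nlinarith [hs.1, hs.2, norm_nonneg u]
  refine ⟨hne, ?_⟩
  have hs1 : 0 < 1 + s := by linarith [hs.1]
  rw [norm_div, div_le_div_iff₀ (norm_pos_iff.2 hne) hs1]
  refine le_of_sq_le_sq ?_ (by positivity)
  have hρ : u.re ^ 2 + u.im ^ 2 ≤ 1 := by
    have : ‖u‖ ^ 2 ≤ 1 := pow_le_one₀ (norm_nonneg _) hu
    rw [← Complex.normSq_eq_norm_sq, Complex.normSq_apply] at this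
    linarith
  have hx : -1 ≤ u.re := by nlinarith [sq_nonneg u.im]
  have e1 : ‖1 - u‖ ^ 2 = (1 - u.re) ^ 2 + u.im ^ 2 := by
    rw [← Complex.normSq_eq_norm_sq, Complex.normSq_apply]
    simp
    ring
  have e2 : ‖1 - s * u‖ ^ 2 = (1 - s * u.re) ^ 2 + (s * u.im) ^ 2 := by
    rw [← Complex.normSq_eq_norm_sq, Complex.normSq_apply]
    simp
    ring
  rw [mul_pow, mul_pow, e1, e2]
  have key : 0 ≤ (1 - s) * ((1 + 3 * s) * (1 - (u.re ^ 2 + u.im ^ 2)) +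
      2 * (1 - s) * (1 + u.re)) := by
    have := hs.1
    have := hs.2
    have h1 : 0 ≤ 1 - s := by linarith
    have h2 : 0 ≤ 1 - (u.re ^ 2 + u.im ^ 2) := by linarith
    have h3 : 0 ≤ 1 + u.re := by linarith
    positivity
  nlinarith [key]

theorem norm_inner_sphere_le (τ : Sphere d) {z : EuclideanSpace ℂ (Fin d)} (hz : ‖z‖ ≤ 1) :
    ‖(inner ℂ (τ : EuclideanSpace ℂ (Fin d)) z : ℂ)‖ ≤ 1 := by
  refine (norm_inner_le_norm _ _).trans ?_
  rw [mem_sphere_zero_iff_norm.1 τ.2, one_mul]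
  exact hz

theorem zeroFactor_zero (T : Finset (Sphere d)) (s : ℝ) : zeroFactor T s 0 = 1 := by
  simp [zeroFactor]

theorem norm_zeroFactor_le (T : Finset (Sphere d)) {s : ℝ} (hs : s ∈ Set.Ioo (0 : ℝ) 1)
    {z : EuclideanSpace ℂ (Fin d)} (hz : ‖z‖ ≤ 1) :
    ‖zeroFactor T s z‖ ≤ (2 / (1 + s)) ^ T.card := by
  rw [zeroFactor, norm_prod]
  exact (Finset.prod_le_prod (fun _ _ => norm_nonneg _) fun τ _ =>
    (norm_one_sub_div_le hs (norm_inner_sphere_le τ hz)).2).trans_eq (Finset.prod_const _)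

theorem differentiableOn_zeroFactor (T : Finset (Sphere d)) {s : ℝ} (hs : s ∈ Set.Ioo (0 : ℝ) 1) :
    DifferentiableOn ℂ (zeroFactor T s) (Metric.closedBall 0 1) := by
  have h : ∀ τ : Sphere d, Differentiable ℂ fun z : EuclideanSpace ℂ (Fin d) =>
      (inner ℂ (τ : EuclideanSpace ℂ (Fin d)) z : ℂ) := fun τ =>
    (innerSL ℂ (τ : EuclideanSpace ℂ (Fin d))).differentiable
  classical
  unfold zeroFactor
  induction T using Finset.induction_on with
  | empty => simp
  | insert τ T hτ ih =>
    simp only [Finset.prod_insert hτ, div_eq_mul_inv] at ih ⊢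
    refine DifferentiableOn.mul ?_ ih
    refine ((h τ).const_sub 1).differentiableOn.mul
      ((((h τ).const_mul (s : ℂ)).const_sub 1).differentiableOn.inv fun z hz => ?_)
    exact (norm_one_sub_div_le hs (norm_inner_sphere_le τ (mem_closedBall_zero_iff.1 hz))).1

theorem zeroFactor_eq_zero {T : Finset (Sphere d)} {τ : Sphere d} (hτ : τ ∈ T) (s : ℝ) :
    zeroFactor T s τ = 0 := by
  refine Finset.prod_eq_zero hτ ?_
  rw [inner_self_eq_norm_sq_to_K, mem_sphere_zero_iff_norm.1 τ.2]
  simp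

/-- A finite discrete measure is carried by a finite set up to arbitrarily small mass. -/
theorem IsDiscrete.exists_finset {X : Type*} [MeasurableSpace X] [MeasurableSingletonClass X]
    {ν : Measure X} [IsFiniteMeasure ν] (hν : IsDiscrete ν) {η : ℝ≥0∞} (hη : 0 < η) :
    ∃ T : Finset X, ν (T : Set X)ᶜ < η := by
  classical
  obtain ⟨S, hS, hS0⟩ := hν
  rcases S.eq_empty_or_nonempty with rfl | hne
  · exact ⟨∅, by simpa using lt_of_eq_of_lt hS0 hη⟩
  obtain ⟨e, rfl⟩ := hS.exists_eq_range hne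
  have h := tendsto_measure_iInter_atTop (μ := ν)
    (s := fun n : ℕ => (((Finset.range n).image e : Finset X) : Set X)ᶜ)
    (fun n => (Finset.measurableSet _).compl.nullMeasurableSet)
    (fun m n hmn => Set.compl_subset_compl.2 (Finset.coe_subset.2
      (Finset.image_subset_image (Finset.range_mono hmn)))) ⟨0, measure_ne_top _ _⟩
  have h2 : ⋂ n : ℕ, (((Finset.range n).image e : Finset X) : Set X)ᶜ = (Set.range e)ᶜ := by
    rw [← Set.compl_iUnion]
    congr 1
    ext x
    simp only [Set.mem_iUnion, Finset.mem_coe, Finset.mem_image, Finset.mem_range, Set.mem_range]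
    exact ⟨fun ⟨_, i, _, hi⟩ => ⟨i, hi⟩, fun ⟨i, hi⟩ => ⟨i + 1, i, by omega, hi⟩⟩
  rw [h2, hS0] at h
  obtain ⟨n, hn⟩ := (h.eventually (gt_mem_nhds hη)).exists
  exact ⟨_, hn⟩

theorem lintegral_decomp {μ μs : Measure (Sphere d)} {w : Sphere d → ℝ}
    (hw : Integrable w (sigma d))
    (hdecomp : μ = (sigma d).withDensity (fun ζ => ENNReal.ofReal (w ζ)) + μs)
    {g : Sphere d → ℝ≥0∞} (hg : Measurable g) :
    ∫⁻ ζ, g ζ ∂μ = ∫⁻ ζ, g ζ * ENNReal.ofReal (w ζ) ∂(sigma d) + ∫⁻ ζ, g ζ ∂μs := by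
  rw [hdecomp, lintegral_add_measure, lintegral_withDensity_eq_lintegral_mul₀
    hw.aemeasurable.ennreal_ofReal hg.aemeasurable]
  simp only [Pi.mul_apply, mul_comm]

/-- The absolutely continuous part of the norms of the dilations converges to that of the boundary
values. -/
theorem tendsto_lintegral_dilation [IsFiniteMeasure (sigma d)] {w : Sphere d → ℝ}
    (hw : Integrable w (sigma d)) {f : EuclideanSpace ℂ (Fin d) → ℂ} (hf : IsHInfty f)
    {r : ℕ → ℝ} (hr : ∀ k, r k ∈ Set.Ioo (0 : ℝ) 1) (hr1 : Tendsto r atTop (𝓝 1)) :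
    Tendsto (fun k => ∫⁻ ζ : Sphere d, ‖f (r k • (ζ : EuclideanSpace ℂ (Fin d)))‖ₑ ^ 2 *
        ENNReal.ofReal (w ζ) ∂(sigma d)) atTop
      (𝓝 (∫⁻ ζ, ‖boundaryValue f ζ‖ₑ ^ 2 * ENNReal.ofReal (w ζ) ∂(sigma d))) := by
  have hlim := ae_sigma_exists_tendsto_radial hf
  obtain ⟨hd, C, hC⟩ := hf
  refine tendsto_lintegral_of_dominated_convergence' (fun ζ => ENNReal.ofReal C ^ 2 *
    ENNReal.ofReal (w ζ)) (fun k => ?_) (fun k => ?_) ?_ ?_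
  · have : Measurable fun ζ : Sphere d => ‖f (r k • (ζ : EuclideanSpace ℂ (Fin d)))‖ₑ ^ 2 :=
      ((continuous_dilation hd (hr k)).measurable.enorm).pow_const 2
    exact this.aemeasurable.mul hw.aemeasurable.ennreal_ofReal
  · refine Eventually.of_forall fun ζ => ?_
    simp only
    rw [← ofReal_norm]
    gcongr
    exact hC _ (smul_sphere_mem_ball (hr k) ζ)
  · rw [lintegral_const_mul'' _ hw.aemeasurable.ennreal_ofReal]
    exact ENNReal.mul_ne_top (by finiteness) hw.lintegral_lt_top.ne
  · filter_upwards [hlim] with ζ ⟨c, hc⟩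
    rw [boundaryValue_eq_of_tendsto hc]
    have h1 : Tendsto r atTop (𝓝[<] 1) :=
      tendsto_nhdsWithin_iff.2 ⟨hr1, Eventually.of_forall fun k => (hr k).2⟩
    refine ENNReal.Tendsto.mul_const ?_ (Or.inr ENNReal.ofReal_ne_top)
    exact ENNReal.Tendsto.pow (hc.comp h1).enorm

/-- The upper bound up to a factor that tends to one as `s → 1`, and an error that stems from the mass
of the singular part outside the finite set `T`. The test functions are the dilations of
`zeroFactor T s * f`. -/
theorem ofReal_christoffelFunction_le_add (hd : 1 ≤ d) {μ μs : Measure (Sphere d)}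
    [IsProbabilityMeasure μ] [IsFiniteMeasure μs] (hμ : IsNontrivial μ) {w : Sphere d → ℝ}
    (hw : Integrable w (sigma d))
    (hdecomp : μ = (sigma d).withDensity (fun ζ => ENNReal.ofReal (w ζ)) + μs)
    {f : EuclideanSpace ℂ (Fin d) → ℂ} (hf : DifferentiableOn ℂ f (Metric.ball 0 1)) {C : ℝ}
    (hC : ∀ z ∈ Metric.ball 0 1, ‖f z‖ ≤ C) (hf0 : f 0 = 1) (T : Finset (Sphere d)) {s : ℝ}
    (hs : s ∈ Set.Ioo (0 : ℝ) 1) :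
    ENNReal.ofReal (christoffelFunction μ 0) ≤
      ENNReal.ofReal ((2 / (1 + s)) ^ T.card) ^ 2 *
        ((∫⁻ ζ, ‖boundaryValue f ζ‖ₑ ^ 2 * ENNReal.ofReal (w ζ) ∂(sigma d)) +
          ENNReal.ofReal C ^ 2 * μs (T : Set (Sphere d))ᶜ) := by
  have := isProbabilityMeasure_sigma hd
  set K : ℝ := (2 / (1 + s)) ^ T.card with hK
  have hK0 : 0 ≤ K := by
    have := hs.1
    positivity
  set F : EuclideanSpace ℂ (Fin d) → ℂ := fun z => zeroFactor T s z * f z with hF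
  have hG := differentiableOn_zeroFactor T hs
  have hFd : DifferentiableOn ℂ F (Metric.ball 0 1) := (hG.mono Metric.ball_subset_closedBall).mul hf
  have hGK : ∀ z ∈ Metric.ball 0 1, ‖zeroFactor T s z‖ ≤ K := fun z hz =>
    norm_zeroFactor_le T hs (mem_ball_zero_iff.1 hz).le
  have hFC : ∀ z ∈ Metric.ball 0 1, ‖F z‖ ≤ K * C := by
    intro z hz
    rw [hF, norm_mul]
    exact mul_le_mul (hGK z hz) (hC z hz) (norm_nonneg _) hK0
  set r : ℕ → ℝ := fun k => 1 - 1 / ((k : ℝ) + 2) with hr_def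
  have hr : ∀ k, r k ∈ Set.Ioo (0 : ℝ) 1 := by
    intro k
    have h1 : (0 : ℝ) < (k : ℝ) + 2 := by positivity
    have h2 : 1 / ((k : ℝ) + 2) < 1 := by
      rw [div_lt_one h1]
      linarith [(Nat.cast_nonneg k : (0 : ℝ) ≤ k)]
    have h3 : 0 < 1 / ((k : ℝ) + 2) := by positivity
    exact ⟨by simp only [hr_def]; linarith, by simp only [hr_def]; linarith⟩
  have hr1 : Tendsto r atTop (𝓝 1) := by
    have h1 : Tendsto (fun k : ℕ => 1 / ((k : ℝ) + 2)) atTop (𝓝 0) := by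
      refine tendsto_const_nhds.div_atTop ?_
      exact tendsto_atTop_add_const_right _ _ tendsto_natCast_atTop_atTop
    simpa [hr_def] using h1.const_sub 1
  have hAC := tendsto_lintegral_dilation hw ⟨hf, C, hC⟩ hr hr1
  -- on the finite set `T` the test functions tend to zero
  have hT : Tendsto (fun k => ∑ τ ∈ T, ‖F (r k • (τ : EuclideanSpace ℂ (Fin d)))‖ₑ ^ 2 * μs {τ})
      atTop (𝓝 0) := by
    rw [show (0 : ℝ≥0∞) = ∑ _τ ∈ T, 0 by simp]
    refine tendsto_finsetSum _ fun τ hτ => ?_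
    have h1 : Tendsto (fun k => zeroFactor T s (r k • (τ : EuclideanSpace ℂ (Fin d)))) atTop
        (𝓝 0) := by
      have hτ1 : (τ : EuclideanSpace ℂ (Fin d)) ∈ Metric.closedBall 0 1 :=
        Metric.sphere_subset_closedBall τ.2
      have h2 := hG.continuousOn _ hτ1
      rw [ContinuousWithinAt, zeroFactor_eq_zero hτ] at h2
      refine h2.comp (tendsto_nhdsWithin_iff.2 ⟨?_, Eventually.of_forall fun k =>
        Metric.ball_subset_closedBall (smul_sphere_mem_ball (hr k) τ)⟩)
      simpa using hr1.smul_const (τ : EuclideanSpace ℂ (Fin d))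
    have h3 : Tendsto (fun k => F (r k • (τ : EuclideanSpace ℂ (Fin d)))) atTop (𝓝 0) := by
      refine h1.zero_mul_isBoundedUnder_le ⟨C, ?_⟩
      exact eventually_map.2 (Eventually.of_forall fun k => hC _ (smul_sphere_mem_ball (hr k) τ))
    have h4 := ENNReal.Tendsto.mul_const (ENNReal.Tendsto.pow h3.enorm (n := 2))
      (Or.inr (measure_ne_top μs {τ}))
    simpa using h4
  have hbound : ∀ k, ENNReal.ofReal (christoffelFunction μ 0) ≤
      ENNReal.ofReal K ^ 2 * (∫⁻ ζ : Sphere d, ‖f (r k • (ζ : EuclideanSpace ℂ (Fin d)))‖ₑ ^ 2 *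
        ENNReal.ofReal (w ζ) ∂(sigma d)) +
      (∑ τ ∈ T, ‖F (r k • (τ : EuclideanSpace ℂ (Fin d)))‖ₑ ^ 2 * μs {τ} +
        ENNReal.ofReal K ^ 2 * (ENNReal.ofReal C ^ 2 * μs (T : Set (Sphere d))ᶜ)) := by
    intro k
    refine (ofReal_christoffelFunction_le hd hμ hFd hFC (by simp [hF, zeroFactor_zero, hf0])
      (hr k)).trans ?_
    rw [lintegral_decomp hw hdecomp
      (((continuous_dilation hFd (hr k)).measurable.enorm).pow_const 2)]
    refine add_le_add ?_ ?_
    · rw [← lintegral_const_mul' _ _ (by finiteness)]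
      refine lintegral_mono fun ζ => ?_
      simp only [hF]
      rw [enorm_mul, mul_pow, mul_assoc]
      gcongr
      rw [← ofReal_norm]
      exact ENNReal.ofReal_le_ofReal (hGK _ (smul_sphere_mem_ball (hr k) ζ))
    · rw [← lintegral_add_compl _ (Finset.measurableSet T), lintegral_finset]
      gcongr
      rw [← mul_assoc, ← mul_pow, ← ENNReal.ofReal_mul hK0, ← setLIntegral_const]
      refine setLIntegral_mono measurable_const fun ζ _ => ?_
      rw [← ofReal_norm]
      gcongr
      exact hFC _ (smul_sphere_mem_ball (hr k) ζ)
  have hlim := (ENNReal.Tendsto.const_mul (a := ENNReal.ofReal K ^ 2) hAC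
    (Or.inr (by finiteness))).add (hT.add_const
      (ENNReal.ofReal K ^ 2 * (ENNReal.ofReal C ^ 2 * μs (T : Set (Sphere d))ᶜ)))
  rw [zero_add, ← mul_add] at hlim
  exact ge_of_tendsto' hlim hbound

/-- The upper bound: `λ_∞(0)` is at most the weighted norm of any bounded holomorphic function with
value one at the origin. A discrete singular part does not count. -/
theorem ofReal_christoffelFunction_le_lintegral (hd : 1 ≤ d) {μ μs : Measure (Sphere d)}
    [IsProbabilityMeasure μ] [IsFiniteMeasure μs] (hμ : IsNontrivial μ) {w : Sphere d → ℝ}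
    (hw : Integrable w (sigma d))
    (hdecomp : μ = (sigma d).withDensity (fun ζ => ENNReal.ofReal (w ζ)) + μs)
    (hdiscrete : IsDiscrete μs) {f : EuclideanSpace ℂ (Fin d) → ℂ} (hf : IsHInfty f)
    (hf0 : f 0 = 1) :
    ENNReal.ofReal (christoffelFunction μ 0) ≤
      ∫⁻ ζ, ‖boundaryValue f ζ‖ₑ ^ 2 * ENNReal.ofReal (w ζ) ∂(sigma d) := by
  obtain ⟨hfd, C, hC⟩ := hf
  set A := ∫⁻ ζ, ‖boundaryValue f ζ‖ₑ ^ 2 * ENNReal.ofReal (w ζ) ∂(sigma d) with hA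
  have hT : ∀ T : Finset (Sphere d), ENNReal.ofReal (christoffelFunction μ 0) ≤
      A + ENNReal.ofReal C ^ 2 * μs (T : Set (Sphere d))ᶜ := by
    intro T
    set B := A + ENNReal.ofReal C ^ 2 * μs (T : Set (Sphere d))ᶜ with hB
    have h1 : Tendsto (fun s : ℝ => ENNReal.ofReal ((2 / (1 + s)) ^ T.card) ^ 2 * B)
        (𝓝[<] 1) (𝓝 (1 * B)) := by
      have h2 : Tendsto (fun s : ℝ => (2 / (1 + s)) ^ T.card) (𝓝 1) (𝓝 1) := by
        have : ContinuousAt (fun s : ℝ => (2 / (1 + s)) ^ T.card) 1 := by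
          refine ContinuousAt.pow (ContinuousAt.div (by fun_prop) (by fun_prop) (by norm_num)) _
        have h3 := this.tendsto
        norm_num at h3
        exact h3
      have h3 := (ENNReal.Tendsto.pow (ENNReal.tendsto_ofReal h2) (n := 2)).mono_left
        (nhdsWithin_le_nhds (s := Set.Iio 1))
      refine ENNReal.Tendsto.mul_const ?_ (Or.inl one_ne_zero)
      simpa using h3
    rw [one_mul] at h1
    refine ge_of_tendsto h1 ?_
    filter_upwards [Ioo_mem_nhdsLT (show (0 : ℝ) < 1 by norm_num)] with s hs
    exact ofReal_christoffelFunction_le_add hd hμ hw hdecomp hfd hC hf0 T hs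
  have h1 : Tendsto (fun η : ℝ≥0∞ => A + ENNReal.ofReal C ^ 2 * η) (𝓝[>] 0) (𝓝 A) := by
    have h2 : Tendsto (fun η : ℝ≥0∞ => A + ENNReal.ofReal C ^ 2 * η) (𝓝 0)
        (𝓝 (A + ENNReal.ofReal C ^ 2 * 0)) :=
      (ENNReal.Tendsto.const_mul tendsto_id (Or.inr (by finiteness))).const_add A
    rw [mul_zero, add_zero] at h2
    exact h2.mono_left nhdsWithin_le_nhds
  refine ge_of_tendsto h1 ?_
  filter_upwards [self_mem_nhdsWithin] with η hη
  obtain ⟨T, hTη⟩ := hdiscrete.exists_finset hη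
  refine (hT T).trans ?_
  gcongr

end SzegoBall

theorem mainTheorem2 (d : ℕ) (μ μs : MeasureTheory.Measure (SzegoBall.Sphere d))
    [MeasureTheory.IsProbabilityMeasure μ] (hμ : SzegoBall.IsNontrivial μ)
    (w : SzegoBall.Sphere d → ℝ)
    (hw : MeasureTheory.Integrable w (SzegoBall.sigma d))
    (hw_nonneg : ∀ᵐ ζ ∂(SzegoBall.sigma d), 0 ≤ w ζ)
    (hdecomp : μ = (SzegoBall.sigma d).withDensity (fun ζ => ENNReal.ofReal (w ζ)) + μs)
    (hsing : μs.MutuallySingular (SzegoBall.sigma d))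
    (hdiscrete : SzegoBall.IsDiscrete μs)
    (hf : ∃ f : EuclideanSpace ℂ (Fin d) → ℂ, SzegoBall.IsHInfty f ∧ f 0 = 1 ∧
      ∫⁻ ζ, ‖SzegoBall.boundaryValue f ζ‖ₑ ^ 2 * ENNReal.ofReal (w ζ) ∂(SzegoBall.sigma d)
        ≤ SzegoBall.szegoEntropy w) :
    Tendsto (fun n => SzegoBall.christoffelApprox μ n 0) atTop
        (𝓝 (SzegoBall.christoffelFunction μ 0)) ∧
      ((SzegoBall.christoffelFunction μ 0 : ℝ) : EReal) = (SzegoBall.szegoEntropy w : EReal) := by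
  open SzegoBall in
  have hd : 1 ≤ d := by
    -- in dimension zero the sphere is empty and carries no probability measure
    by_contra h
    obtain rfl : d = 0 := by omega
    obtain ⟨ζ⟩ := nonempty_of_isProbabilityMeasure μ
    have h1 : ‖(ζ : EuclideanSpace ℂ (Fin 0))‖ = 1 := mem_sphere_zero_iff_norm.1 ζ.2
    rw [Subsingleton.elim (ζ : EuclideanSpace ℂ (Fin 0)) 0, norm_zero] at h1
    exact zero_ne_one h1
  have hlim := tendsto_christoffelApprox hd hμ
  refine ⟨hlim, ?_⟩
  have hprob := isProbabilityMeasure_sigma hd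
  have hfin : IsFiniteMeasure μs :=
    ⟨lt_of_le_of_lt (by rw [hdecomp]; exact Measure.le_add_left le_rfl _) (measure_lt_top μ Set.univ)⟩
  obtain ⟨f, hfH, hf0, hfE⟩ := hf
  have hupper : ENNReal.ofReal (christoffelFunction μ 0) ≤ szegoEntropy w :=
    (ofReal_christoffelFunction_le_lintegral hd hμ hw hdecomp hdiscrete hfH hf0).trans hfE
  have hlower : szegoEntropy w ≤ ENNReal.ofReal (christoffelFunction μ 0) := by
    refine ge_of_tendsto' (ENNReal.tendsto_ofReal hlim) fun n => ?_
    obtain ⟨p, hp0, hp⟩ := exists_integral_eq_christoffelApprox hd hμ n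
    have hpc : Continuous fun ζ : Sphere d => polyEval p ζ := by fun_prop
    rw [← hp, ofReal_integral_norm_sq hpc, lintegral_decomp hw hdecomp
      (hpc.measurable.enorm.pow_const 2)]
    exact (szegoEntropy_le_lintegral hw hw_nonneg hp0).trans le_self_add
  have hnonneg : 0 ≤ christoffelFunction μ 0 :=
    ge_of_tendsto' hlim fun n => inv_nonneg.2 (Finset.sum_nonneg fun _ _ => by positivity)
  rw [← le_antisymm hupper hlower, EReal.coe_ennreal_ofReal, max_eq_left hnonneg]
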